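/- Let $A$ be a unital associative $\mathbb{C}$-algebra and $\Gamma$ an $A$-bimodule (for example a first order differential calculus over a Hopf $*$-algebra $A$). Let $\Gamma^{\otimes k}$ be the $k$-fold tensor power over $A$ (with $\Gamma^{\otimes 0}=A$) and $\Gamma^{\otimes}=\bigoplus_{k\ge 0}\Gamma^{\otimes k}$ the tensor algebra of $\Gamma$ over $A$. Let $\sigma$ be an automorphism of the $A$-bimodule $\Gamma\otimes_A\Gamma$ satisfying $\sigma_{12}\sigma_{23}\sigma_{12}=\sigma_{23}\sigma_{12}\sigma_{23}$ on $\Gamma^{\otimes 3}$, and let $g:\Gamma\otimes_A\Gamma\to A$ be a non-degenerate $A$-bimodule homomorphism with $g\sigma=g$ and $g_{12}\sigma_{23}^{\pm1}\sigma_{12}^{\pm1}=g_{23}$ on $\Gamma^{\otimes 3}$ (equal signs). Let $A_k=\sum_{w\in S_k}\mathrm{sgn}(w)\,\sigma_w$ be Woronowicz's antisymmetrizer on $\Gamma^{\otimes k}$, where $\sigma_w=\sigma_{i_1,i_1+1}\cdots\sigma_{i_r,i_r+1}$ for a reduced expression $w=s_{i_1}\cdots s_{i_r}$ in the adjacent transpositions,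 and let $\Gamma^\wedge$ be the quotient of $\Gamma^\otimes$ by the two-sided ideal generated by the kernels $\ker A_k$, $k\ge 0$, with product $\wedge$. For $\omega\in\Gamma$ and $\rho\in\Gamma^{\otimes l}$ put $\langle\omega,\rho\rangle=0$ if $l=0$ and $$\langle\omega,\rho\rangle=g_{12}\bigl(\omega\otimes B_{1,l-1}(\rho)\bigr)\in\Gamma^{\otimes(l-1)},\qquad B_{1,l-1}=\sum_{j=0}^{l-1}(-1)^j\sigma_{12}\sigma_{23}\cdots\sigma_{j,j+1},$$ if $l\ge1$. Let $\mathrm{Cl}(\Gamma,\sigma,g)$ be the quotient of $\Gamma^\otimes$ by the two-sided ideal generated by the elements $\rho_2-g(\rho_2)$ with $\rho_2\in\ker(\mathrm{id}-\sigma)\subset\Gamma\otimes_A\Gamma$. Then: 1. An element $x\in\Gamma^{\otimes k}$ vanishes in $\Gamma^\wedge$ if and only if $A_k x=0$, and $\Gamma^\wedge$ is the direct sum of the images of the $\Gamma^{\otimes k}$; that is, $\Gamma^\wedge=\bigoplus_{k\ge0}\Gamma^{\otimes k}/\ker A_k$. 2. The contraction $\langle\omega,\cdot\rangle$ is well defined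 on $\Gamma^\wedge$, and there is a unique representation $\triangleright$ of the algebra $\mathrm{Cl}(\Gamma,\sigma,g)$ on $\Gamma^\wedge$ such that $$a\triangleright\rho=a\rho,\qquad \omega\triangleright\rho=\omega\wedge\rho+\langle\omega,\rho\rangle\qquad(a\in A,\ \omega\in\Gamma,\ \rho\in\Gamma^\wedge).$$ 3. The canonical map $A\oplus\Gamma\to\mathrm{Cl}(\Gamma,\sigma,g)$ is injective; in particular $A$ and $\Gamma$ embed into $\mathrm{Cl}(\Gamma,\sigma,g)$. -/

import Mathlib

open scoped TensorProduct DirectSum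

universe u

set_option linter.unusedSectionVars false

noncomputable section

namespace QClifford

/-! ## The tensor product `M ⊗_A N` over a noncommutative algebra `A`

`A` is a `ℂ`-algebra.  An `A`-bimodule is a module over `A` (left action) and over `Aᵐᵒᵖ`
(right action, `m · a = MulOpposite.op a • m`), the two actions commuting and both extending the
same action of `ℂ`. -/

section Tensor

variable (A : Type u) [Ring A] [Algebra ℂ A]
variable (M : Type u) [AddCommGroup M] [Module ℂ M] [Module A M] [Module Aᵐᵒᵖ M]
  [SMulCommClass A Aᵐᵒᵖ M] [IsScalarTower ℂ A M] [IsScalarTower ℂ Aᵐᵒᵖ M]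
variable (N : Type u) [AddCommGroup N] [Module ℂ N] [Module A N] [IsScalarTower ℂ A N]

/-- The balancing relations `m·a ⊗ n - m ⊗ a·n`. -/
def balanced : Submodule A (M ⊗[ℂ] N) :=
  Submodule.span A {x | ∃ (m : M) (a : A) (n : N),
    x = (MulOpposite.op a • m) ⊗ₜ[ℂ] n - m ⊗ₜ[ℂ] (a • n)}

/-- `M ⊗_A N` for an `A`-bimodule `M` and a left `A`-module `N`. -/
def BTensor : Type u := (M ⊗[ℂ] N) ⧸ balanced A M N

instance : AddCommGroup (BTensor A M N) :=
  inferInstanceAs (AddCommGroup ((M ⊗[ℂ] N) ⧸ balanced A M N))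

instance : Module ℂ (BTensor A M N) :=
  inferInstanceAs (Module ℂ ((M ⊗[ℂ] N) ⧸ balanced A M N))

/-- The left action `a · (m ⊗ n) = (a · m) ⊗ n`. -/
instance : Module A (BTensor A M N) :=
  inferInstanceAs (Module A ((M ⊗[ℂ] N) ⧸ balanced A M N))

instance : IsScalarTower ℂ A (BTensor A M N) :=
  inferInstanceAs (IsScalarTower ℂ A ((M ⊗[ℂ] N) ⧸ balanced A M N))

/-- The projection `M ⊗_ℂ N → M ⊗_A N`. -/
def proj : (M ⊗[ℂ] N) →ₗ[A] BTensor A M N := (balanced A M N).mkQ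

variable {M N}

/-- The pure tensor `m ⊗_A n`. -/
def tmul (m : M) (n : N) : BTensor A M N := proj A M N (m ⊗ₜ[ℂ] n)

theorem tmul_add (m : M) (n n' : N) : tmul A m (n + n') = tmul A m n + tmul A m n' := by
  simp only [tmul, TensorProduct.tmul_add, map_add]

theorem add_tmul (m m' : M) (n : N) : tmul A (m + m') n = tmul A m n + tmul A m' n := by
  simp only [tmul, TensorProduct.add_tmul, map_add]

theorem smul_tmul_left (a : A) (m : M) (n : N) : tmul A (a • m) n = a • tmul A m n := by
  simp only [tmul]
  rw [← TensorProduct.smul_tmul', map_smul]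

theorem op_smul_tmul (a : A) (m : M) (n : N) :
    tmul A (MulOpposite.op a • m) n = tmul A m (a • n) := by
  have h : proj A M N ((MulOpposite.op a • m) ⊗ₜ[ℂ] n - m ⊗ₜ[ℂ] (a • n)) = 0 :=
    (Submodule.Quotient.mk_eq_zero _).2 (Submodule.subset_span ⟨m, a, n, rfl⟩)
  rw [map_sub, sub_eq_zero] at h
  exact h

variable {A}

theorem tensor_induction {p : BTensor A M N → Prop} (h0 : p 0)
    (ht : ∀ m n, p (tmul A m n)) (ha : ∀ x y, p x → p y → p (x + y)) (x : BTensor A M N) :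
    p x := by
  obtain ⟨y, rfl⟩ : ∃ y, proj A M N y = x := (balanced A M N).mkQ_surjective x
  induction y using TensorProduct.induction_on with
  | zero => rw [map_zero]; exact h0
  | tmul m n => exact ht m n
  | add x y hx hy => rw [map_add]; exact ha _ _ hx hy

variable {P : Type u} [AddCommGroup P]

theorem balanced_C (f : M → N → P)
    (hb : ∀ (a : A) m n, f (MulOpposite.op a • m) n = f m (a • n)) (c : ℂ) (m : M) (n : N) :
    f (c • m) n = f m (c • n) := by
  have h := hb (algebraMap ℂ A c) m n
  rwa [algebraMap_smul, Algebra.algebraMap_eq_smul_one, MulOpposite.op_smul, MulOpposite.op_one,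
    smul_assoc, one_smul] at h

/-- Auxiliary for `liftAdd`: the additive map on `M ⊗_ℂ N`. -/
def liftAux (f : M → N → P) (h1 : ∀ m m' n, f (m + m') n = f m n + f m' n)
    (h2 : ∀ m n n', f m (n + n') = f m n + f m n')
    (hb : ∀ (a : A) m n, f (MulOpposite.op a • m) n = f m (a • n)) : (M ⊗[ℂ] N) →+ P :=
  TensorProduct.liftAddHom
    (AddMonoidHom.mk' (fun m => AddMonoidHom.mk' (f m) (h2 m))
      (fun m m' => AddMonoidHom.ext fun n => h1 m m' n))
    (fun c m n => balanced_C f hb c m n)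

theorem liftAux_balanced (x : M ⊗[ℂ] N) (hx : x ∈ balanced A M N) :
    ∀ (f : M → N → P) (h1 : ∀ m m' n, f (m + m') n = f m n + f m' n)
      (h2 : ∀ m n n', f m (n + n') = f m n + f m n')
      (hb : ∀ (a : A) m n, f (MulOpposite.op a • m) n = f m (a • n)),
      liftAux f h1 h2 hb x = 0 := by
  induction hx using Submodule.span_induction with
  | mem x h =>
    obtain ⟨m, a, n, rfl⟩ := h
    intro f h1 h2 hb
    rw [map_sub, sub_eq_zero]
    exact hb a m n
  | zero => intro f h1 h2 hb; exact map_zero _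
  | add x y _ _ hx hy =>
    intro f h1 h2 hb
    rw [map_add, hx f h1 h2 hb, hy f h1 h2 hb, add_zero]
  | smul b x _ hx =>
    intro f h1 h2 hb
    rw [← hx (fun m n => f (b • m) n) (fun m m' n => by rw [smul_add, h1])
      (fun m n n' => h2 _ n n') (fun a m n => by rw [smul_comm b, hb])]
    clear hx
    have : ∀ y : M ⊗[ℂ] N, liftAux f h1 h2 hb (b • y) =
        liftAux (A := A) (fun m n => f (b • m) n) (fun m m' n => by rw [smul_add, h1])
          (fun m n n' => h2 _ n n') (fun a m n => by rw [smul_comm b, hb]) y := by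
      intro y
      induction y using TensorProduct.induction_on with
      | zero => rw [smul_zero, map_zero, map_zero]
      | tmul m n => rfl
      | add x y hx hy => rw [smul_add, map_add, map_add, hx, hy]
    exact this x

/-- The additive map out of `M ⊗_A N` given by a balanced biadditive map. -/
def liftAdd (f : M → N → P) (h1 : ∀ m m' n, f (m + m') n = f m n + f m' n)
    (h2 : ∀ m n n', f m (n + n') = f m n + f m n')
    (hb : ∀ (a : A) m n, f (MulOpposite.op a • m) n = f m (a • n)) : BTensor A M N →+ P :=
  QuotientAddGroup.lift (balanced A M N).toAddSubgroup (liftAux f h1 h2 hb)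
    (fun x hx => liftAux_balanced x hx f h1 h2 hb)

theorem liftAdd_tmul (f : M → N → P) (h1 : ∀ m m' n, f (m + m') n = f m n + f m' n)
    (h2 : ∀ m n n', f m (n + n') = f m n + f m n')
    (hb : ∀ (a : A) m n, f (MulOpposite.op a • m) n = f m (a • n)) (m : M) (n : N) :
    liftAdd f h1 h2 hb (tmul A m n) = f m n := rfl

variable [Module A P]

/-- The left `A`-linear map out of `M ⊗_A N` given by a balanced biadditive map that is left
`A`-linear in the first argument. -/
def lift (f : M → N → P) (h1 : ∀ m m' n, f (m + m') n = f m n + f m' n)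
    (h2 : ∀ m n n', f m (n + n') = f m n + f m n')
    (hl : ∀ (a : A) m n, f (a • m) n = a • f m n)
    (hb : ∀ (a : A) m n, f (MulOpposite.op a • m) n = f m (a • n)) : BTensor A M N →ₗ[A] P where
  toFun := liftAdd f h1 h2 hb
  map_add' := map_add _
  map_smul' a x := by
    rw [RingHom.id_apply]
    induction x using tensor_induction with
    | h0 => simp only [smul_zero, map_zero]
    | ht m n => rw [← smul_tmul_left, liftAdd_tmul, liftAdd_tmul, hl]
    | ha x y hx hy => simp only [smul_add, map_add, hx, hy]

theorem lift_tmul (f : M → N → P) (h1 : ∀ m m' n, f (m + m') n = f m n + f m' n)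
    (h2 : ∀ m n n', f m (n + n') = f m n + f m n')
    (hl : ∀ (a : A) m n, f (a • m) n = a • f m n)
    (hb : ∀ (a : A) m n, f (MulOpposite.op a • m) n = f m (a • n)) (m : M) (n : N) :
    lift f h1 h2 hl hb (tmul A m n) = f m n := rfl

theorem hom_ext {φ ψ : BTensor A M N →ₗ[A] P} (h : ∀ m n, φ (tmul A m n) = ψ (tmul A m n)) :
    φ = ψ := by
  ext x
  induction x using tensor_induction with
  | h0 => rw [map_zero, map_zero]
  | ht m n => exact h m n
  | ha x y hx hy => rw [map_add, map_add, hx, hy]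

variable [Module ℂ P] [IsScalarTower ℂ A P]

variable (M) in
/-- `id ⊗ φ` for a left `A`-linear map `φ`. -/
def lTensor (φ : N →ₗ[A] P) : BTensor A M N →ₗ[A] BTensor A M P :=
  lift (fun m n => tmul A m (φ n))
    (fun m m' n => add_tmul A m m' _)
    (fun m n n' => by rw [map_add, tmul_add])
    (fun a m n => smul_tmul_left A a m _)
    (fun a m n => by rw [op_smul_tmul, map_smul])

theorem lTensor_tmul (φ : N →ₗ[A] P) (m : M) (n : N) :
    lTensor M φ (tmul A m n) = tmul A m (φ n) := rfl

end Tensor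

section Bimodule

variable {A : Type u} [Ring A] [Algebra ℂ A]
variable {M : Type u} [AddCommGroup M] [Module ℂ M] [Module A M] [Module Aᵐᵒᵖ M]
  [SMulCommClass A Aᵐᵒᵖ M] [IsScalarTower ℂ A M] [IsScalarTower ℂ Aᵐᵒᵖ M]
variable {N : Type u} [AddCommGroup N] [Module ℂ N] [Module A N] [Module Aᵐᵒᵖ N]
  [SMulCommClass A Aᵐᵒᵖ N] [IsScalarTower ℂ A N] [IsScalarTower ℂ Aᵐᵒᵖ N]

/-- Right multiplication by an element of `A` on a bimodule, as a left `A`-linear map. -/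
def rightMul (b : Aᵐᵒᵖ) : N →ₗ[A] N where
  toFun n := b • n
  map_add' := smul_add b
  map_smul' a n := (smul_comm a b n).symm

/-- The right action `(m ⊗ n) · a = m ⊗ (n · a)`. -/
instance : Module Aᵐᵒᵖ (BTensor A M N) where
  smul b := lTensor M (rightMul b)
  one_smul x := by
    change lTensor M (rightMul 1) x = x
    induction x using tensor_induction with
    | h0 => simp
    | ht m n => rw [lTensor_tmul]; simp [rightMul]
    | ha x y hx hy => rw [map_add, hx, hy]
  mul_smul b c x := by
    change lTensor M (rightMul (b * c)) x = lTensor M (rightMul b) (lTensor M (rightMul c) x)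
    induction x using tensor_induction with
    | h0 => simp
    | ht m n => simp only [lTensor_tmul]; simp [rightMul, mul_smul]
    | ha x y hx hy => simp only [map_add, hx, hy]
  smul_zero b := map_zero (lTensor M (rightMul b))
  smul_add b := map_add (lTensor M (rightMul b))
  add_smul b c x := by
    change lTensor M (rightMul (b + c)) x = lTensor M (rightMul b) x + lTensor M (rightMul c) x
    induction x using tensor_induction with
    | h0 => simp
    | ht m n => simp only [lTensor_tmul]; simp [rightMul, add_smul, tmul_add]
    | ha x y hx hy => simp only [map_add, hx, hy]; abel
  zero_smul x := by
    change lTensor M (rightMul 0) x = 0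
    induction x using tensor_induction with
    | h0 => simp
    | ht m n =>
      rw [lTensor_tmul]
      have h := tmul_add A m (0 : N) 0
      rw [add_zero, left_eq_add] at h
      simpa [rightMul] using h
    | ha x y hx hy => rw [map_add, hx, hy, add_zero]

theorem op_smul_eq (b : Aᵐᵒᵖ) (x : BTensor A M N) : b • x = lTensor M (rightMul b) x := rfl

theorem op_smul_tmul_right (b : Aᵐᵒᵖ) (m : M) (n : N) :
    b • tmul A m n = tmul A m (b • n) := lTensor_tmul _ _ _

instance : SMulCommClass A Aᵐᵒᵖ (BTensor A M N) where
  smul_comm a b x := (map_smul (lTensor M (rightMul b)) a x).symm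

instance : IsScalarTower ℂ Aᵐᵒᵖ (BTensor A M N) where
  smul_assoc c b x := by
    induction x using tensor_induction with
    | h0 => simp
    | ht m n =>
      rw [op_smul_tmul_right, op_smul_tmul_right, smul_assoc,
        ← balanced_C (A := A) (tmul A) (op_smul_tmul A) c m, ← algebraMap_smul A c m,
        smul_tmul_left, algebraMap_smul]
    | ha x y hx hy => simp only [smul_add, hx, hy]

variable {Q : Type u} [AddCommGroup Q] [Module ℂ Q] [Module A Q] [Module Aᵐᵒᵖ Q]
  [SMulCommClass A Aᵐᵒᵖ Q] [IsScalarTower ℂ A Q] [IsScalarTower ℂ Aᵐᵒᵖ Q]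
variable (L : Type u) [AddCommGroup L] [Module ℂ L] [Module A L] [IsScalarTower ℂ A L]

/-- `φ ⊗ id` for a homomorphism of bimodules `φ`. -/
def rTensor (φ : M →ₗ[A] Q)
    (hφ : ∀ (a : A) (m : M), φ (MulOpposite.op a • m) = MulOpposite.op a • φ m) :
    BTensor A M L →ₗ[A] BTensor A Q L :=
  lift (fun m l => tmul A (φ m) l)
    (fun m m' l => by rw [map_add, add_tmul])
    (fun m l l' => tmul_add A _ l l')
    (fun a m l => by rw [map_smul, smul_tmul_left])
    (fun a m l => by rw [hφ, op_smul_tmul])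

/-- `x ↦ x ⊗ l` regrouped: `m ⊗ n ↦ m ⊗ (n ⊗ l)`, for fixed `l`. -/
def assocAux (l : L) : BTensor A M N →ₗ[A] BTensor A M (BTensor A N L) :=
  lift (fun m n => tmul A m (tmul A n l))
    (fun m m' n => add_tmul A m m' _)
    (fun m n n' => by rw [add_tmul, tmul_add])
    (fun a m n => smul_tmul_left A a m _)
    (fun a m n => by rw [op_smul_tmul, smul_tmul_left])

theorem assocAux_tmul (l : L) (m : M) (n : N) :
    assocAux L l (tmul A m n) = tmul A m (tmul A n l) := rfl

/-- `(m ⊗ n) ⊗ l ↦ m ⊗ (n ⊗ l)`. -/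
def assoc : BTensor A (BTensor A M N) L →ₗ[A] BTensor A M (BTensor A N L) :=
  lift (fun x l => assocAux L l x)
    (fun x x' l => map_add _ x x')
    (fun x l l' => by
      induction x using tensor_induction with
      | h0 => simp only [map_zero, add_zero]
      | ht m n => simp only [assocAux_tmul, tmul_add]
      | ha x y hx hy => simp only [map_add, hx, hy]; abel)
    (fun a x l => map_smul _ a x)
    (fun a x l => by
      induction x using tensor_induction with
      | h0 => simp only [map_zero, smul_zero]
      | ht m n => simp only [op_smul_tmul_right, assocAux_tmul, op_smul_tmul]
      | ha x y hx hy => simp only [smul_add, map_add, hx, hy])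

theorem assoc_tmul (m : M) (n : N) (l : L) :
    assoc L (tmul A (tmul A m n) l) = tmul A m (tmul A n l) := rfl

/-- `n ⊗ l ↦ (m ⊗ n) ⊗ l`, for fixed `m`. -/
def assocInvAux (m : M) : BTensor A N L →+ BTensor A (BTensor A M N) L :=
  liftAdd (fun n l => tmul A (tmul A m n) l)
    (fun n n' l => by rw [tmul_add, add_tmul])
    (fun n l l' => tmul_add A _ l l')
    (fun a n l => by rw [← op_smul_tmul_right, op_smul_tmul])

theorem assocInvAux_tmul (m : M) (n : N) (l : L) :
    assocInvAux L m (tmul A n l) = tmul A (tmul A m n) l := rfl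

/-- `m ⊗ (n ⊗ l) ↦ (m ⊗ n) ⊗ l`. -/
def assocInv : BTensor A M (BTensor A N L) →ₗ[A] BTensor A (BTensor A M N) L :=
  lift (fun m x => assocInvAux L m x)
    (fun m m' x => by
      induction x using tensor_induction with
      | h0 => simp only [map_zero, add_zero]
      | ht n l => simp only [assocInvAux_tmul, add_tmul]
      | ha x y hx hy => simp only [map_add, hx, hy]; abel)
    (fun m x x' => map_add _ x x')
    (fun a m x => by
      induction x using tensor_induction with
      | h0 => simp only [map_zero, smul_zero]
      | ht n l => simp only [assocInvAux_tmul, smul_tmul_left]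
      | ha x y hx hy => simp only [smul_add, map_add, hx, hy])
    (fun a m x => by
      induction x using tensor_induction with
      | h0 => simp only [map_zero, smul_zero]
      | ht n l => simp only [← smul_tmul_left, assocInvAux_tmul, op_smul_tmul]
      | ha x y hx hy => simp only [smul_add, map_add, hx, hy])

theorem assocInv_tmul (m : M) (n : N) (l : L) :
    assocInv L (tmul A m (tmul A n l)) = tmul A (tmul A m n) l := rfl

/-- `φ₁₂ = φ ⊗ id : M ⊗ (M ⊗ L) → M ⊗ (M ⊗ L)` for a bimodule endomorphism `φ` of `M ⊗ M`. -/
def onFirstTwo (φ : BTensor A M M →ₗ[A] BTensor A M M)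
    (hφ : ∀ (a : A) x, φ (MulOpposite.op a • x) = MulOpposite.op a • φ x) :
    BTensor A M (BTensor A M L) →ₗ[A] BTensor A M (BTensor A M L) :=
  assoc L ∘ₗ rTensor L φ hφ ∘ₗ assocInv L

/-- `γ₁₂ : M ⊗ (M ⊗ L) → L`, `m ⊗ n ⊗ l ↦ γ(m ⊗ n) · l`, for a bimodule map `γ : M ⊗ M → A`
(with `A ⊗_A L` identified with `L`). -/
def contractFirstTwo (γ : BTensor A M M →ₗ[A] A)
    (hγ : ∀ (a : A) x, γ (MulOpposite.op a • x) = γ x * a) :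
    BTensor A M (BTensor A M L) →ₗ[A] L :=
  (lift (fun x l => γ x • l)
    (fun x x' l => by rw [map_add, add_smul])
    (fun x l l' => smul_add _ l l')
    (fun a x l => by rw [map_smul, smul_eq_mul, mul_smul])
    (fun a x l => by rw [hγ, mul_smul])) ∘ₗ assocInv L

/-- `γ₂₃ : M ⊗ (M ⊗ M) → M`, `m ⊗ x ↦ m · γ(x)`, for a left linear map `γ : M ⊗ M → A`
(with `M ⊗_A A` identified with `M`). -/
def contractLastTwo (γ : BTensor A M M →ₗ[A] A) : BTensor A M (BTensor A M M) →ₗ[A] M :=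
  lift (fun m x => MulOpposite.op (γ x) • m)
    (fun m m' x => smul_add _ m m')
    (fun m x x' => by rw [map_add, MulOpposite.op_add, add_smul])
    (fun a m x => (smul_comm a _ m).symm)
    (fun a m x => by rw [map_smul, smul_eq_mul, MulOpposite.op_mul, mul_smul])

end Bimodule

/-! ## Braidings and `σ`-metrics -/

section Data

variable (A : Type u) [Ring A] [Algebra ℂ A]
variable (Γ : Type u) [AddCommGroup Γ] [Module ℂ Γ] [Module A Γ] [Module Aᵐᵒᵖ Γ]
  [SMulCommClass A Aᵐᵒᵖ Γ] [IsScalarTower ℂ A Γ] [IsScalarTower ℂ Aᵐᵒᵖ Γ]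

/-- An automorphism `σ` of the `A`-bimodule `Γ ⊗_A Γ` with
`σ₁₂ σ₂₃ σ₁₂ = σ₂₃ σ₁₂ σ₂₃` on `Γ ⊗_A Γ ⊗_A Γ`. -/
structure Braiding where
  /-- the automorphism of left modules -/
  toEquiv : BTensor A Γ Γ ≃ₗ[A] BTensor A Γ Γ
  map_op_smul : ∀ (a : A) x,
    toEquiv.toLinearMap (MulOpposite.op a • x) = MulOpposite.op a • toEquiv.toLinearMap x
  braid :
    onFirstTwo Γ toEquiv.toLinearMap map_op_smul ∘ₗ lTensor Γ toEquiv.toLinearMap ∘ₗ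
        onFirstTwo Γ toEquiv.toLinearMap map_op_smul =
      lTensor Γ toEquiv.toLinearMap ∘ₗ onFirstTwo Γ toEquiv.toLinearMap map_op_smul ∘ₗ
        lTensor Γ toEquiv.toLinearMap

variable {A Γ}

namespace Braiding

/-- `σ : Γ ⊗_A Γ → Γ ⊗_A Γ` as a left linear map. -/
def hom (σ : Braiding A Γ) : BTensor A Γ Γ →ₗ[A] BTensor A Γ Γ := σ.toEquiv.toLinearMap

/-- `σ⁻¹`. -/
def inv (σ : Braiding A Γ) : BTensor A Γ Γ →ₗ[A] BTensor A Γ Γ := σ.toEquiv.symm.toLinearMap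

theorem inv_op_smul (σ : Braiding A Γ) (a : A) (x : BTensor A Γ Γ) :
    σ.inv (MulOpposite.op a • x) = MulOpposite.op a • σ.inv x := by
  have h := σ.map_op_smul a (σ.toEquiv.symm x)
  simp only [LinearEquiv.coe_coe, LinearEquiv.apply_symm_apply] at h
  simp only [inv, LinearEquiv.coe_coe]
  rw [← h, LinearEquiv.symm_apply_apply]

/-- `σ₁₂` on `Γ ⊗ (Γ ⊗ L)`. -/
def hom₁₂ (σ : Braiding A Γ) (L : Type u) [AddCommGroup L] [Module ℂ L] [Module A L]
    [IsScalarTower ℂ A L] : BTensor A Γ (BTensor A Γ L) →ₗ[A] BTensor A Γ (BTensor A Γ L) :=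
  onFirstTwo L σ.hom σ.map_op_smul

/-- `σ₁₂⁻¹` on `Γ ⊗ (Γ ⊗ L)`. -/
def inv₁₂ (σ : Braiding A Γ) (L : Type u) [AddCommGroup L] [Module ℂ L] [Module A L]
    [IsScalarTower ℂ A L] : BTensor A Γ (BTensor A Γ L) →ₗ[A] BTensor A Γ (BTensor A Γ L) :=
  onFirstTwo L σ.inv σ.inv_op_smul

end Braiding

/-- A `σ`-metric: a nondegenerate homomorphism of bimodules `g : Γ ⊗_A Γ → A` with `g σ = g` and
`g₁₂ σ₂₃ σ₁₂ = g₂₃`, `g₁₂ σ₂₃⁻¹ σ₁₂⁻¹ = g₂₃` on `Γ ⊗_A Γ ⊗_A Γ`. -/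
structure SigmaMetric (σ : Braiding A Γ) where
  /-- the underlying left linear map -/
  hom : BTensor A Γ Γ →ₗ[A] A
  map_op_smul : ∀ (a : A) x, hom (MulOpposite.op a • x) = hom x * a
  nondegenerate_left : ∀ ω : Γ, (∀ ω' : Γ, hom (tmul A ω ω') = 0) → ω = 0
  nondegenerate_right : ∀ ω' : Γ, (∀ ω : Γ, hom (tmul A ω ω') = 0) → ω' = 0
  comp_braiding : hom ∘ₗ σ.hom = hom
  compat :
    contractFirstTwo Γ hom map_op_smul ∘ₗ lTensor Γ σ.hom ∘ₗ σ.hom₁₂ Γ = contractLastTwo hom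
  compat_inv :
    contractFirstTwo Γ hom map_op_smul ∘ₗ lTensor Γ σ.inv ∘ₗ σ.inv₁₂ Γ = contractLastTwo hom

end Data

/-! ## Tensor powers, antisymmetrizers and contractions -/

/-- A bundled left `A`-module (used only for the recursion defining the tensor powers). -/
structure LeftMod (A : Type u) [Ring A] [Algebra ℂ A] where
  /-- the underlying type -/
  carrier : Type u
  [grp : AddCommGroup carrier]
  [modC : Module ℂ carrier]
  [modA : Module A carrier]
  [tower : IsScalarTower ℂ A carrier]

attribute [instance] LeftMod.grp LeftMod.modC LeftMod.modA LeftMod.tower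

section Powers

variable (A : Type u) [Ring A] [Algebra ℂ A]
variable (Γ : Type u) [AddCommGroup Γ] [Module ℂ Γ] [Module A Γ] [Module Aᵐᵒᵖ Γ]
  [SMulCommClass A Aᵐᵒᵖ Γ] [IsScalarTower ℂ A Γ] [IsScalarTower ℂ Aᵐᵒᵖ Γ]

/-- `Γ^{⊗0} = A` and `Γ^{⊗(k+1)} = Γ ⊗_A Γ^{⊗k}`, bundled. -/
@[reducible] def tpowMod : ℕ → LeftMod A
  | 0 => ⟨A⟩
  | k + 1 => ⟨BTensor A Γ (tpowMod k).carrier⟩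

/-- The `k`-fold tensor power `Γ^{⊗k}` over `A`. -/
abbrev TPow (k : ℕ) : Type u := (tpowMod A Γ k).carrier

variable {A Γ}

/-- `σ_{i+1,i+2}` on `Γ^{⊗k}`: the braiding applied to the tensor factors number `i` and `i+1`,
counted from `0` (the identity if `i + 2 > k`). -/
def braidAt (σ : Braiding A Γ) : (k i : ℕ) → (TPow A Γ k →ₗ[A] TPow A Γ k)
  | 0, _ => LinearMap.id
  | 1, 0 => LinearMap.id
  | k + 2, 0 => σ.hom₁₂ (TPow A Γ k)
  | k + 1, i + 1 => lTensor Γ (braidAt σ k i)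

/-- The composition `σ_{i₁} σ_{i₂} ⋯ σ_{iᵣ}` on `Γ^{⊗k}` along a word `i₁ i₂ … iᵣ`. -/
def braidWord (σ : Braiding A Γ) (k : ℕ) (w : List ℕ) : Module.End A (TPow A Γ k) :=
  (w.map (braidAt σ k)).prod

/-- A reduced word of the permutation `w` in the adjacent transpositions `s_i = (i, i+1)`.  With
`j = w⁻¹(0)` one has `w = u s_0 s_1 ⋯ s_{j-1}` with `u` fixing `0` and
`ℓ(w) = ℓ(u) + j`, and one continues with `u` as a permutation of the remaining letters. -/
def reducedWord : (k : ℕ) → Equiv.Perm (Fin k) → List ℕ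
  | 0, _ => []
  | k + 1, w =>
    (reducedWord k (Equiv.Perm.decomposeFin (w * (Fin.cycleRange (w.symm 0))⁻¹)).2).map (· + 1) ++
      List.range (w.symm 0)

/-- Woronowicz' antisymmetrizer `A_k = ∑_{w ∈ S_k} sgn(w) σ_w`. -/
def antisymmetrizer (σ : Braiding A Γ) (k : ℕ) : Module.End A (TPow A Γ k) :=
  ∑ w : Equiv.Perm (Fin k), (Equiv.Perm.sign w : ℤ) • braidWord σ k (reducedWord k w)

/-- `B_{1,l-1} = id - σ₁₂ + σ₁₂σ₂₃ - ⋯ ± σ₁₂σ₂₃⋯σ_{l-1,l}` on `Γ^{⊗l}`, the factor in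
`A_l = (id ⊗ A_{l-1}) B_{1,l-1}`. -/
def shuffle (σ : Braiding A Γ) (l : ℕ) : Module.End A (TPow A Γ l) :=
  ∑ j ∈ Finset.range l, (-1 : ℤ) ^ j • braidWord σ l (List.range j)

/-- The contraction `Γ ⊗ Γ^{⊗(l+1)} → Γ^{⊗l}`,
`ω ⊗ ρ ↦ ⟨ω, ρ⟩ = g₁₂(ω ⊗ B_{1,l}(ρ))`. -/
def contraction {σ : Braiding A Γ} (g : SigmaMetric σ) (l : ℕ) :
    BTensor A Γ (TPow A Γ (l + 1)) →ₗ[A] TPow A Γ l :=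
  contractFirstTwo (TPow A Γ l) g.hom g.map_op_smul ∘ₗ lTensor Γ (shuffle σ (l + 1))

end Powers

/-! ## The tensor algebra, the exterior algebra and the Clifford algebra -/

section Algebras

variable (A : Type u) [Ring A] [Algebra ℂ A]
variable (Γ : Type u) [AddCommGroup Γ] [Module ℂ Γ] [Module A Γ] [Module Aᵐᵒᵖ Γ]
  [SMulCommClass A Aᵐᵒᵖ Γ] [IsScalarTower ℂ A Γ] [IsScalarTower ℂ Aᵐᵒᵖ Γ]

/-- The relations of the tensor algebra of the bimodule `Γ` over `A`, on the generators
`(a, ω) ∈ A × Γ`. -/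
inductive TRel : TensorAlgebra ℂ (A × Γ) → TensorAlgebra ℂ (A × Γ) → Prop
  | one : TRel (TensorAlgebra.ι ℂ ((1 : A), (0 : Γ))) 1
  | mul (a b : A) : TRel (TensorAlgebra.ι ℂ (a * b, (0 : Γ)))
      (TensorAlgebra.ι ℂ (a, (0 : Γ)) * TensorAlgebra.ι ℂ (b, (0 : Γ)))
  | left (a : A) (ω : Γ) : TRel (TensorAlgebra.ι ℂ ((0 : A), a • ω))
      (TensorAlgebra.ι ℂ (a, (0 : Γ)) * TensorAlgebra.ι ℂ ((0 : A), ω))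
  | right (a : A) (ω : Γ) : TRel (TensorAlgebra.ι ℂ ((0 : A), MulOpposite.op a • ω))
      (TensorAlgebra.ι ℂ ((0 : A), ω) * TensorAlgebra.ι ℂ (a, (0 : Γ)))

/-- The tensor algebra `Γ^⊗` of the `A`-bimodule `Γ`: the universal `ℂ`-algebra with an algebra
homomorphism from `A` and an `A`-bimodule homomorphism from `Γ`. -/
def TAlg : Type u := RingQuot (TRel A Γ)

instance : Ring (TAlg A Γ) := inferInstanceAs (Ring (RingQuot (TRel A Γ)))

instance : Algebra ℂ (TAlg A Γ) := inferInstanceAs (Algebra ℂ (RingQuot (TRel A Γ)))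

namespace TAlg

/-- The projection from the free algebra. -/
def mk : TensorAlgebra ℂ (A × Γ) →ₐ[ℂ] TAlg A Γ := RingQuot.mkAlgHom ℂ (TRel A Γ)

theorem mk_rel {x y : TensorAlgebra ℂ (A × Γ)} (h : TRel A Γ x y) : mk A Γ x = mk A Γ y :=
  RingQuot.mkAlgHom_rel ℂ h

/-- `A → Γ^⊗`. -/
def ofA : A →ₐ[ℂ] TAlg A Γ :=
  AlgHom.ofLinearMap
    ((mk A Γ).toLinearMap ∘ₗ TensorAlgebra.ι ℂ ∘ₗ LinearMap.inl ℂ A Γ)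
    (by simpa using mk_rel A Γ (TRel.one))
    (fun a b => by simpa using mk_rel A Γ (TRel.mul a b))

/-- `Γ → Γ^⊗`. -/
def ι : Γ →ₗ[ℂ] TAlg A Γ :=
  (mk A Γ).toLinearMap ∘ₗ TensorAlgebra.ι ℂ ∘ₗ LinearMap.inr ℂ A Γ

theorem ι_smul (a : A) (ω : Γ) : ι A Γ (a • ω) = ofA A Γ a * ι A Γ ω := by
  simpa [ι, ofA] using mk_rel A Γ (TRel.left a ω)

theorem ι_op_smul (a : A) (ω : Γ) : ι A Γ (MulOpposite.op a • ω) = ι A Γ ω * ofA A Γ a := by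
  simpa [ι, ofA] using mk_rel A Γ (TRel.right a ω)

/-- `Γ^⊗` as a left `A`-module. -/
instance : Module A (TAlg A Γ) := Module.compHom _ (ofA A Γ).toRingHom

theorem smul_def (a : A) (t : TAlg A Γ) : a • t = ofA A Γ a * t := rfl

instance : IsScalarTower ℂ A (TAlg A Γ) where
  smul_assoc c a t := by rw [smul_def, smul_def, map_smul, smul_mul_assoc]

/-- The canonical map `Γ^{⊗k} → Γ^⊗`, `ω₁ ⊗ ⋯ ⊗ ω_k ↦ ω₁ ⋯ ω_k`. -/
def ofTPow : (k : ℕ) → (TPow A Γ k →ₗ[A] TAlg A Γ)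
  | 0 =>
    { toFun := fun a : A => ofA A Γ a
      map_add' := fun a b : A => map_add (ofA A Γ) a b
      map_smul' := fun a b : A => map_mul (ofA A Γ) a b }
  | k + 1 =>
    lift (fun ω x => ι A Γ ω * ofTPow k x)
      (fun ω ω' x => by rw [map_add, add_mul])
      (fun ω x x' => by rw [map_add, mul_add])
      (fun a ω x => by rw [ι_smul, smul_def, mul_assoc])
      (fun a ω x => by rw [ι_op_smul, map_smul, smul_def, mul_assoc])

/-- The canonical map `Γ ⊗_A Γ → Γ^⊗`, `ω ⊗ ω' ↦ ω ω'`. -/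
def ofTwo : BTensor A Γ Γ →ₗ[A] TAlg A Γ :=
  lift (fun ω ω' => ι A Γ ω * ι A Γ ω')
    (fun ω ω₁ x => by rw [map_add, add_mul])
    (fun ω x x' => by rw [map_add, mul_add])
    (fun a ω x => by rw [ι_smul, smul_def, mul_assoc])
    (fun a ω x => by rw [ι_op_smul, ι_smul, mul_assoc])

end TAlg

variable {A Γ}

/-- The relations of the exterior algebra: the elements of `ker A_k` vanish, for every `k`. -/
inductive ExtRel (σ : Braiding A Γ) : TAlg A Γ → TAlg A Γ → Prop
  | ker (k : ℕ) (x : TPow A Γ k) (hx : antisymmetrizer σ k x = 0) :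
      ExtRel σ (TAlg.ofTPow A Γ k x) 0

/-- Woronowicz' external algebra `Γ^∧`: the quotient of `Γ^⊗` by the two-sided ideal of the
kernels of the antisymmetrizers. -/
def Ext (σ : Braiding A Γ) : Type u := RingQuot (ExtRel σ)

instance (σ : Braiding A Γ) : Ring (Ext σ) := inferInstanceAs (Ring (RingQuot (ExtRel σ)))

instance (σ : Braiding A Γ) : Algebra ℂ (Ext σ) :=
  inferInstanceAs (Algebra ℂ (RingQuot (ExtRel σ)))

namespace Ext

variable (σ : Braiding A Γ)

/-- The projection `Γ^⊗ → Γ^∧`. -/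
def mk : TAlg A Γ →ₐ[ℂ] Ext σ := RingQuot.mkAlgHom ℂ (ExtRel σ)

/-- `A → Γ^∧`. -/
def ofA : A →ₐ[ℂ] Ext σ := (mk σ).comp (TAlg.ofA A Γ)

/-- `Γ → Γ^∧`. -/
def ι : Γ →ₗ[ℂ] Ext σ := (mk σ).toLinearMap ∘ₗ TAlg.ι A Γ

/-- `Γ^{⊗k} → Γ^∧`, `ω₁ ⊗ ⋯ ⊗ ω_k ↦ ω₁ ∧ ⋯ ∧ ω_k`. -/
def ofTPow (k : ℕ) : TPow A Γ k →ₗ[ℂ] Ext σ :=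
  (mk σ).toLinearMap ∘ₗ (TAlg.ofTPow A Γ k).restrictScalars ℂ

end Ext

/-- The relations `ρ₂ = g(ρ₂)` for `ρ₂ ∈ ker(id - σ)`. -/
inductive CliffRel {σ : Braiding A Γ} (g : SigmaMetric σ) : TAlg A Γ → TAlg A Γ → Prop
  | ker (x : BTensor A Γ Γ) (hx : x - σ.hom x = 0) :
      CliffRel g (TAlg.ofTwo A Γ x) (TAlg.ofA A Γ (g.hom x))

/-- The quantum Clifford algebra `Cl(Γ, σ, g)`. -/
def Cliff {σ : Braiding A Γ} (g : SigmaMetric σ) : Type u := RingQuot (CliffRel g)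

instance {σ : Braiding A Γ} (g : SigmaMetric σ) : Ring (Cliff g) :=
  inferInstanceAs (Ring (RingQuot (CliffRel g)))

instance {σ : Braiding A Γ} (g : SigmaMetric σ) : Algebra ℂ (Cliff g) :=
  inferInstanceAs (Algebra ℂ (RingQuot (CliffRel g)))

namespace Cliff

variable {σ : Braiding A Γ} (g : SigmaMetric σ)

/-- The projection `Γ^⊗ → Cl(Γ, σ, g)`. -/
def mk : TAlg A Γ →ₐ[ℂ] Cliff g := RingQuot.mkAlgHom ℂ (CliffRel g)

/-- `A → Cl(Γ, σ, g)`. -/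
def ofA : A →ₐ[ℂ] Cliff g := (mk g).comp (TAlg.ofA A Γ)

/-- `Γ → Cl(Γ, σ, g)`. -/
def ι : Γ →ₗ[ℂ] Cliff g := (mk g).toLinearMap ∘ₗ TAlg.ι A Γ

end Cliff

end Algebras

end QClifford

end

/-! The operators `negBraid`, that is -σ_{i,i+1}, satisfy the braid relations, and A_k is the sum
`BraidRing.sym` of the braid lifts of all permutations in them. Splitting permutations by cosets of
the stabilizer of the first or of the last strand factorizes this sum in four ways, two on each
side. They are proved from the braid relations alone, in any ring.

Two of them put id ⊗ A_k, respectively A_k ⊗ id, on the right of the antisymmetrizer of higher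
degree. Hence tensoring an element of ker A_k with anything, on either side, stays in a kernel: the
sum of the ker A_k is already a two-sided ideal. So ⨁ Γ^{⊗k}/ker A_k carries an action of Γ^∧ by
left multiplication, and evaluating this action at 1 inverts the obvious map to Γ^∧
(`ExtModel.equivExt`). This is part 1, and it reduces the rest to computations with tensors modulo
ker A_k.

The contraction descends because A_l ⟨ω, x⟩ = g₁₂(ω ⊗ A_{l+1} x), which follows from A_{l+1} = (id ⊗
A_l) B_{1,l} (`antisymmetrizer_contraction`). For the Clifford relation let ρ = σρ act on x of
degree k through creation plus annihilation; the result has three homogeneous parts. Degree k + 2: ρ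
⊗ x is killed by A_{k+2}, which has 1 - σ₁₂ as a right factor. Degree k: B(η ⊗ x) = η ⊗ x - σ₁₂(η ⊗
Bx) and g₁₂σ₂₃σ₁₂ = g₂₃ give g(ρ)x plus a term depending only on σρ - ρ (`tmul_contraction_add`).
Degree k - 2: applying A_{k-2} to the double contraction gives g₁₂g₂₃(ρ ⊗ A_k x). Here A_k has 1 -
σ₁₂ as a left factor, and both compatibilities of g with σ move that σ over to ρ, so the term
vanishes (`antisymmetrizer_contractionTwice`). Thus ρ acts as the scalar g(ρ). Finally a + ω ∈ Cl
sends 1 to a + ω ∈ Γ^∧, and A_0 and A_1 are identities, so nothing in A ⊕ Γ is lost. -/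

namespace QClifford

/-! ## Braid combinatorics in a ring -/

namespace BraidRing

variable {R : Type*} [Ring R] (s : ℕ → R)

/-- `s_m s_{m+1} ⋯ s_{m+n-1}`. -/
def up : ℕ → ℕ → R
  | _, 0 => 1
  | m, n + 1 => s m * up (m + 1) n

/-- `s_{m+n-1} ⋯ s_{m+1} s_m`. -/
def down : ℕ → ℕ → R
  | _, 0 => 1
  | m, n + 1 => down (m + 1) n * s m

/-- `1 + s_m + s_m s_{m+1} + ⋯ + s_m ⋯ s_{m+n-1}`. -/
def sumUp : ℕ → ℕ → R
  | _, 0 => 1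
  | m, n + 1 => 1 + s m * sumUp (m + 1) n

/-- `1 + s_m + s_{m+1} s_m + ⋯ + s_{m+n-1} ⋯ s_m`. -/
def sumDown : ℕ → ℕ → R
  | _, 0 => 1
  | m, n + 1 => 1 + sumDown (m + 1) n * s m

/-- `1 + s_{m+n-1} + s_{m+n-2} s_{m+n-1} + ⋯ + s_m ⋯ s_{m+n-1}`. -/
def lastUp : ℕ → ℕ → R
  | _, 0 => 1
  | m, n + 1 => lastUp (m + 1) n + up s m (n + 1)

/-- `1 + s_{m+n-1} + s_{m+n-1} s_{m+n-2} + ⋯ + s_{m+n-1} ⋯ s_m`. -/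
def lastDown : ℕ → ℕ → R
  | _, 0 => 1
  | m, n + 1 => lastDown (m + 1) n + down s m (n + 1)

/-- The sum of `s_w` over the permutations `w` of the `k` strands `m, …, m + k - 1`. -/
def sym : ℕ → ℕ → R
  | _, 0 => 1
  | m, k + 1 => sym (m + 1) k * sumUp s m k

theorem up_succ' (m n : ℕ) : up s m (n + 1) = up s m n * s (m + n) := by
  induction n generalizing m with
  | zero => simp [up]
  | succ n ih => rw [up, ih, up, mul_assoc]; congr 3; omega

theorem sumUp_succ' (m n : ℕ) : sumUp s m (n + 1) = sumUp s m n + up s m (n + 1) := by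
  induction n generalizing m with
  | zero => simp [sumUp, up]
  | succ n ih => rw [sumUp, ih, mul_add, ← add_assoc]; rfl

theorem sumDown_succ' (m n : ℕ) : sumDown s m (n + 1) = sumDown s m n + down s m (n + 1) := by
  induction n generalizing m with
  | zero => simp [sumDown, down]
  | succ n ih => rw [sumDown, ih, add_mul, ← add_assoc]; rfl

theorem sumUp_eq_sum (n : ℕ) :
    sumUp s 0 n = ∑ j ∈ Finset.range (n + 1), ((List.range j).map s).prod := by
  have h : ∀ j, ((List.range j).map s).prod = up s 0 j := by
    intro j
    induction j with
    | zero => simp [up]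
    | succ j ih => rw [List.range_succ]; simp [ih, up_succ']
  induction n with
  | zero => simp [sumUp]
  | succ n ih => rw [sumUp_succ', ih, Finset.sum_range_succ _ (n + 1), h (n + 1)]

/-- The braid relations among the generators `s_0, …, s_{N-2}`. -/
structure IsBraid (N : ℕ) : Prop where
  comm : ∀ i j, i + 2 ≤ j → s i * s j = s j * s i
  braid : ∀ i, i + 3 ≤ N → s i * s (i + 1) * s i = s (i + 1) * s i * s (i + 1)

variable {s} {N : ℕ} (h : IsBraid s N)
include h

theorem comm_up (i m n : ℕ) (hi : i + 2 ≤ m) : s i * up s m n = up s m n * s i := by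
  induction n generalizing m with
  | zero => simp [up]
  | succ n ih =>
    rw [up, ← mul_assoc, h.comm i m hi, mul_assoc, ih (m + 1) (by omega), mul_assoc]

theorem comm_down (i m n : ℕ) (hi : i + 2 ≤ m) : s i * down s m n = down s m n * s i := by
  induction n generalizing m with
  | zero => simp [down]
  | succ n ih =>
    rw [down, ← mul_assoc, ih (m + 1) (by omega), mul_assoc, h.comm i m hi, mul_assoc]

theorem comm_lastUp (i m n : ℕ) (hi : i + 2 ≤ m) :
    s i * lastUp s m n = lastUp s m n * s i := by
  induction n generalizing m with
  | zero => simp [lastUp]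
  | succ n ih => rw [lastUp, mul_add, add_mul, ih (m + 1) (by omega), comm_up h i _ _ hi]

/-- The product s_m ⋯ s_{m+n-1} carries one strand across n others and so moves their crossings by
one position. All later shift lemmas are sums and products of this one and its mirror image
`shift_down`. -/
theorem shift_up (m n d : ℕ) (hd : d + 1 < n) (hN : m + n + 1 ≤ N) :
    s (m + d + 1) * up s m n = up s m n * s (m + d) := by
  induction d generalizing m n with
  | zero =>
    obtain ⟨n, rfl⟩ : ∃ k, n = k + 2 := ⟨n - 2, by omega⟩
    have hc := comm_up h m (m + 2) n le_rfl
    simp only [up, add_zero]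
    calc s (m + 1) * (s m * (s (m + 1) * up s (m + 1 + 1) n))
        = (s (m + 1) * s m * s (m + 1)) * up s (m + 2) n := by simp only [mul_assoc]
      _ = s m * s (m + 1) * (s m * up s (m + 2) n) := by
          rw [← h.braid m (by omega)]; simp only [mul_assoc]
      _ = _ := by rw [hc]; simp only [mul_assoc]
  | succ d ih =>
    obtain ⟨n, rfl⟩ : ∃ k, n = k + 1 := ⟨n - 1, by omega⟩
    have := ih (m + 1) n (by omega) (by omega)
    rw [up, ← mul_assoc, ← h.comm m _ (by omega), mul_assoc,
      show m + (d + 1) + 1 = m + 1 + d + 1 by omega, this, mul_assoc]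
    congr 3; omega

theorem shift_down (m n d : ℕ) (hd : d + 1 < n) (hN : m + n + 1 ≤ N) :
    down s m n * s (m + d + 1) = s (m + d) * down s m n := by
  induction d generalizing m n with
  | zero =>
    obtain ⟨n, rfl⟩ : ∃ k, n = k + 2 := ⟨n - 2, by omega⟩
    have hc := comm_down h m (m + 2) n le_rfl
    simp only [down, add_zero]
    calc down s (m + 1 + 1) n * s (m + 1) * s m * s (m + 1)
        = down s (m + 2) n * (s (m + 1) * s m * s (m + 1)) := by simp only [mul_assoc]
      _ = (down s (m + 2) n * s m) * s (m + 1) * s m := by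
          rw [← h.braid m (by omega)]; simp only [mul_assoc]
      _ = _ := by rw [← hc]; simp only [mul_assoc]
  | succ d ih =>
    obtain ⟨n, rfl⟩ : ∃ k, n = k + 1 := ⟨n - 1, by omega⟩
    have := ih (m + 1) n (by omega) (by omega)
    rw [down, mul_assoc, h.comm m _ (by omega), ← mul_assoc,
      show m + (d + 1) + 1 = m + 1 + d + 1 by omega, this, mul_assoc]
    congr 2; omega

theorem sumUp_mul_up (m n d l : ℕ) (hd : d + l < n) (hN : m + n + 1 ≤ N) :
    sumUp s (m + d + 1) l * up s m n = up s m n * sumUp s (m + d) l := by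
  induction l generalizing d with
  | zero => simp [sumUp]
  | succ l ih =>
    have := ih (d + 1) (by omega)
    rw [sumUp, sumUp, add_mul, mul_add, mul_assoc,
      show m + d + 1 + 1 = m + (d + 1) + 1 by omega, this, ← mul_assoc,
      shift_up h m n d (by omega) hN, mul_assoc]
    simp [add_assoc]

theorem sumDown_mul_up (m n d l : ℕ) (hd : d + l < n) (hN : m + n + 1 ≤ N) :
    sumDown s (m + d + 1) l * up s m n = up s m n * sumDown s (m + d) l := by
  induction l generalizing d with
  | zero => simp [sumDown]
  | succ l ih =>
    have := ih (d + 1) (by omega)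
    rw [sumDown, sumDown, add_mul, mul_add, mul_assoc,
      shift_up h m n d (by omega) hN, ← mul_assoc,
      show m + d + 1 + 1 = m + (d + 1) + 1 by omega, this, mul_assoc]
    simp [add_assoc]

theorem sumUp_mul_down (m n d l : ℕ) (hd : d + l < n) (hN : m + n + 1 ≤ N) :
    down s m n * sumUp s (m + d + 1) l = sumUp s (m + d) l * down s m n := by
  induction l generalizing d with
  | zero => simp [sumUp]
  | succ l ih =>
    have := ih (d + 1) (by omega)
    rw [sumUp, sumUp, add_mul, mul_add, ← mul_assoc,
      shift_down h m n d (by omega) hN, mul_assoc,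
      show m + d + 1 + 1 = m + (d + 1) + 1 by omega, this, ← mul_assoc]
    simp [add_assoc]

theorem sym_mul_up (m n d l : ℕ) (hd : d + l ≤ n) (hN : m + n + 1 ≤ N) :
    sym s (m + d + 1) l * up s m n = up s m n * sym s (m + d) l := by
  induction l generalizing d with
  | zero => simp [sym]
  | succ l ih =>
    have := ih (d + 1) (by omega)
    rw [sym, sym, mul_assoc, sumUp_mul_up h m n d l (by omega) hN, ← mul_assoc,
      show m + d + 1 + 1 = m + (d + 1) + 1 by omega, this, mul_assoc]
    simp [add_assoc]

theorem down_mul_sym (m n d l : ℕ) (hd : d + l ≤ n) (hN : m + n + 1 ≤ N) :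
    down s m n * sym s (m + d + 1) l = sym s (m + d) l * down s m n := by
  induction l generalizing d with
  | zero => simp [sym]
  | succ l ih =>
    have := ih (d + 1) (by omega)
    rw [sym, sym, mul_assoc, ← sumUp_mul_down h m n d l (by omega) hN, ← mul_assoc,
      show m + d + 1 + 1 = m + (d + 1) + 1 by omega, this, mul_assoc]
    simp [add_assoc]

/-- Coset decomposition for the last strand instead of the first. The longest summand of `sumUp` is
pulled through `sym` by the shift; the remaining summands are handled by induction on the strands
from m + 1 on. -/
theorem sym_succ_eq_lastUp_mul (m k : ℕ) (hN : m + k + 1 ≤ N) :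
    sym s m (k + 1) = lastUp s m k * sym s m k := by
  induction k generalizing m with
  | zero => simp [sym, sumUp, lastUp]
  | succ k ih =>
    have h1 := ih (m + 1) (by omega)
    have h2 := sym_mul_up h m (k + 1) 0 (k + 1) (by omega) (by omega)
    rw [add_zero] at h2
    calc sym s m (k + 2) = sym s (m + 1) (k + 1) * sumUp s m k
          + sym s (m + 1) (k + 1) * up s m (k + 1) := by rw [sym, sumUp_succ', mul_add]
      _ = lastUp s (m + 1) k * sym s m (k + 1) + up s m (k + 1) * sym s m (k + 1) := by
          rw [h2, h1, mul_assoc, ← sym]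
      _ = _ := by rw [lastUp, add_mul]

/-- The exchange of first-strand and last-strand coset representatives, needed to turn the
factorization with `lastUp` into the one with `sumDown`. -/
theorem lastUp_mul_sumDown (m k : ℕ) (hN : m + k + 2 ≤ N) :
    lastUp s m (k + 1) * sumDown s m k = sumDown s m (k + 1) * lastUp s (m + 1) k := by
  induction k generalizing m with
  | zero => simp [lastUp, sumDown, up]
  | succ k ih =>
    have h1 := ih (m + 1) (by omega)
    have h2 := sumDown_mul_up h m (k + 2) 0 (k + 1) (by omega) (by omega)
    have h3 := comm_lastUp h m (m + 2) k le_rfl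
    rw [add_zero] at h2
    calc lastUp s m (k + 2) * sumDown s m (k + 1)
        = lastUp s (m + 1) (k + 1) * (1 + sumDown s (m + 1) k * s m)
          + up s m (k + 2) * sumDown s m (k + 1) := by rw [lastUp, add_mul, sumDown]
      -- The induction hypothesis exchanges the factors in the first product; in the second, the
      -- shift moves `up` to the right of `sumDown`. Afterwards s_m commutes with `lastUp` on the
      -- strands from m + 2 on, and a common factor appears.
      _ = lastUp s (m + 1) (k + 1) + sumDown s (m + 1) (k + 1) * (lastUp s (m + 2) k * s m)
          + sumDown s (m + 1) (k + 1) * up s m (k + 2) := by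
          rw [h2, mul_add, mul_one, ← mul_assoc, h1, mul_assoc]
      _ = lastUp s (m + 1) (k + 1) + sumDown s (m + 1) (k + 1) * s m *
            (lastUp s (m + 2) k + up s (m + 1) (k + 1)) := by
          rw [← h3, up, mul_add, mul_assoc, mul_assoc, add_assoc]
      _ = _ := by
          change _ = (1 + sumDown s (m + 1) (k + 1) * s m) * lastUp s (m + 1) (k + 1)
          rw [add_mul, one_mul]; rfl

/-- The defining recursion of `sym` with the factors in the opposite order. It is this order that
makes kernels stable under ω ⊗ -. -/
theorem sym_succ_eq_sumDown_mul (m k : ℕ) (hN : m + k + 1 ≤ N) :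
    sym s m (k + 1) = sumDown s m k * sym s (m + 1) k := by
  induction k generalizing m with
  | zero => simp [sym, sumUp, sumDown]
  | succ k ih =>
    rw [sym_succ_eq_lastUp_mul h m (k + 1) (by omega), ih m (by omega), ← mul_assoc,
      lastUp_mul_sumDown h m k (by omega), mul_assoc,
      ← sym_succ_eq_lastUp_mul h (m + 1) k (by omega)]

theorem sym_succ_eq_mul_lastDown (m k : ℕ) (hN : m + k + 1 ≤ N) :
    sym s m (k + 1) = sym s m k * lastDown s m k := by
  induction k generalizing m with
  | zero => simp [sym, sumUp, lastDown]
  | succ k ih =>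
    have h1 := ih (m + 1) (by omega)
    have h2 := down_mul_sym h m (k + 1) 0 (k + 1) (by omega) (by omega)
    rw [add_zero] at h2
    rw [sym_succ_eq_sumDown_mul h m (k + 1) (by omega), sumDown_succ', add_mul, h2, h1,
      ← mul_assoc, ← sym_succ_eq_sumDown_mul h m k (by omega), lastDown, mul_add]

/-- Strands are added one at a time at the end. For general k this yields stability of kernels under
- ⊗ y; for k = 2 it exhibits 1 + s_0 as a right factor. -/
theorem exists_sym_eq_mul_sym (j k : ℕ) (hN : j + k ≤ N) :
    ∃ x, sym s 0 (j + k) = x * sym s 0 k := by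
  induction j with
  | zero => exact ⟨1, by simp⟩
  | succ j ih =>
    obtain ⟨x, hx⟩ := ih (by omega)
    exact ⟨lastUp s 0 (j + k) * x, by
      rw [show j + 1 + k = j + k + 1 by omega, sym_succ_eq_lastUp_mul h 0 (j + k) (by omega), hx,
        mul_assoc]⟩

/-- The mirror image, used with k = 2 for the double contraction, where 1 + s_0 is needed as a left
factor. -/
theorem exists_sym_eq_sym_mul (j k : ℕ) (hN : j + k ≤ N) :
    ∃ x, sym s 0 (j + k) = sym s 0 k * x := by
  induction j with
  | zero => exact ⟨1, by simp⟩
  | succ j ih =>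
    obtain ⟨x, hx⟩ := ih (by omega)
    exact ⟨x * lastDown s 0 (j + k), by
      rw [show j + 1 + k = j + k + 1 by omega, sym_succ_eq_mul_lastDown h 0 (j + k) (by omega), hx,
        mul_assoc]⟩

omit h

theorem sym_zero_two : sym s 0 2 = 1 + s 0 := by simp [sym, sumUp]

section Map

variable {S : Type*} [Ring S] (f : R →+* S) (t : ℕ → S) (hf : ∀ i, f (s i) = t (i + 1))
include hf

theorem map_sumUp (m n : ℕ) : f (sumUp s m n) = sumUp t (m + 1) n := by
  induction n generalizing m with
  | zero => simp [sumUp]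
  | succ n ih => simp [sumUp, ih, hf]

theorem map_sym (m k : ℕ) : f (sym s m k) = sym t (m + 1) k := by
  induction k generalizing m with
  | zero => simp [sym]
  | succ k ih => simp [sym, ih, map_sumUp f t hf]

end Map

end BraidRing

/-! ## Functoriality of the tensor products -/

section Functoriality

variable {A : Type u} [Ring A] [Algebra ℂ A]
variable {M : Type u} [AddCommGroup M] [Module ℂ M] [Module A M] [Module Aᵐᵒᵖ M]
  [SMulCommClass A Aᵐᵒᵖ M] [IsScalarTower ℂ A M] [IsScalarTower ℂ Aᵐᵒᵖ M]
variable {N : Type u} [AddCommGroup N] [Module ℂ N] [Module A N] [IsScalarTower ℂ A N]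
variable {L : Type u} [AddCommGroup L] [Module ℂ L] [Module A L] [IsScalarTower ℂ A L]
variable {L' : Type u} [AddCommGroup L'] [Module ℂ L'] [Module A L'] [IsScalarTower ℂ A L']

theorem smul_tmul_complex (c : ℂ) (m : M) (n : N) : tmul A (c • m) n = c • tmul A m n := by
  rw [← algebraMap_smul A c m, smul_tmul_left, algebraMap_smul]

theorem tmul_smul_complex (c : ℂ) (m : M) (n : N) : tmul A m (c • n) = c • tmul A m n := by
  rw [← smul_tmul_complex, balanced_C (A := A) (tmul A) (op_smul_tmul A)]

theorem tmul_zero (m : M) : tmul A m (0 : N) = 0 := by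
  simpa using tmul_smul_complex (A := A) (0 : ℂ) m (0 : N)

/-- `tmul` as a `ℂ`-bilinear map. -/
noncomputable def tmulLin : M →ₗ[ℂ] N →ₗ[ℂ] BTensor A M N :=
  LinearMap.mk₂ ℂ (tmul A) (add_tmul A) smul_tmul_complex (tmul_add A) tmul_smul_complex

theorem lTensor_comp_apply (φ : L →ₗ[A] L') (ψ : N →ₗ[A] L) (x : BTensor A M N) :
    lTensor M φ (lTensor M ψ x) = lTensor M (φ ∘ₗ ψ) x := by
  have h : lTensor M φ ∘ₗ lTensor M ψ = lTensor M (φ ∘ₗ ψ) := hom_ext fun _ _ => rfl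
  exact LinearMap.congr_fun h x

variable (M N) in
/-- `φ ↦ id ⊗ φ` as a homomorphism of rings. -/
noncomputable def lTensorHom : Module.End A N →+* Module.End A (BTensor A M N) where
  toFun := lTensor M
  map_one' := hom_ext fun _ _ => rfl
  map_mul' _ _ := hom_ext fun _ _ => rfl
  map_zero' := hom_ext fun m _ => tmul_zero m
  map_add' _ _ := hom_ext fun _ _ => tmul_add A _ _ _

theorem lTensorHom_apply (φ : Module.End A N) : lTensorHom M N φ = lTensor M φ := rfl

theorem lTensorHom_tmul (φ : Module.End A N) (m : M) (n : N) :
    lTensorHom M N φ (tmul A m n) = tmul A m (φ n) := rfl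

/-- The elements x ⊗ l with x ∈ M ⊗ M span, and on them an operator in the first two factors acts on
x alone. This avoids handling φ(m ⊗ n) as a sum of pure tensors. -/
theorem hom_ext₃ {P : Type u} [AddCommGroup P] [Module A P]
    {φ ψ : BTensor A M (BTensor A M L) →ₗ[A] P}
    (h : ∀ (l : L) (x : BTensor A M M), φ (assocAux L l x) = ψ (assocAux L l x)) : φ = ψ := by
  refine hom_ext fun m y => ?_
  induction y using tensor_induction with
  | h0 => simp only [tmul_zero, map_zero]
  | ht n l => exact h l (tmul A m n)
  | ha x y hx hy => simp only [tmul_add, map_add, hx, hy]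

/-- `n ↦ n ⊗ l` as a left linear map. -/
noncomputable def tmulRight (l : L) : M →ₗ[A] BTensor A M L where
  toFun m := tmul A m l
  map_add' m m' := add_tmul A m m' l
  map_smul' a m := smul_tmul_left A a m l

theorem assocAux_eq_lTensor (l : L) (x : BTensor A M M) :
    assocAux L l x = lTensor M (tmulRight l) x := by
  have h : assocAux L l = lTensor M (tmulRight (A := A) (M := M) l) := hom_ext fun _ _ => rfl
  exact LinearMap.congr_fun h x

theorem lTensor_lTensor_assocAux (φ : L →ₗ[A] L') (l : L) (x : BTensor A M M) :
    lTensor M (lTensor M φ) (assocAux L l x) = assocAux L' (φ l) x := by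
  induction x using tensor_induction with
  | h0 => simp only [map_zero]
  | ht m n => rfl
  | ha x y hx hy => simp only [map_add, hx, hy]

theorem tmul_sub (m : M) (n n' : N) : tmul A m (n - n') = tmul A m n - tmul A m n' :=
  map_sub (tmulLin (A := A) m) n n'

theorem assocAux_sub (l l' : L) (x : BTensor A M M) :
    assocAux L (l - l') x = assocAux L l x - assocAux L l' x := by
  induction x using tensor_induction with
  | h0 => simp only [map_zero, sub_zero]
  | ht m n => simp only [assocAux_tmul, tmul_sub]
  | ha x y hx hy => simp only [map_add, hx, hy]; abel

theorem assocInv_assocAux (l : L) (x : BTensor A M M) :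
    assocInv L (assocAux L l x) = tmul A x l := by
  induction x using tensor_induction with
  | h0 => rw [map_zero, map_zero]; exact (map_zero (tmulRight (A := A) l)).symm
  | ht m n => rfl
  | ha x y hx hy => rw [map_add, map_add, hx, hy, add_tmul]

theorem onFirstTwo_assocAux (φ : BTensor A M M →ₗ[A] BTensor A M M)
    (hφ : ∀ (a : A) x, φ (MulOpposite.op a • x) = MulOpposite.op a • φ x)
    (l : L) (x : BTensor A M M) :
    onFirstTwo L φ hφ (assocAux L l x) = assocAux L l (φ x) := by
  simp only [onFirstTwo, LinearMap.comp_apply, assocInv_assocAux]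
  rfl

theorem contractFirstTwo_assocAux (γ : BTensor A M M →ₗ[A] A)
    (hγ : ∀ (a : A) x, γ (MulOpposite.op a • x) = γ x * a) (l : L) (x : BTensor A M M) :
    contractFirstTwo L γ hγ (assocAux L l x) = γ x • l := by
  simp only [contractFirstTwo, LinearMap.comp_apply, assocInv_assocAux]
  rfl

/-- Operators on disjoint tensor factors commute. This gives the commutation of distant braidings,
and their compatibility with tensoring on the right. -/
theorem onFirstTwo_natural (φ : BTensor A M M →ₗ[A] BTensor A M M)
    (hφ : ∀ (a : A) x, φ (MulOpposite.op a • x) = MulOpposite.op a • φ x) (ψ : L →ₗ[A] L')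
    (x : BTensor A M (BTensor A M L)) :
    onFirstTwo L' φ hφ (lTensor M (lTensor M ψ) x) =
      lTensor M (lTensor M ψ) (onFirstTwo L φ hφ x) := by
  have h : onFirstTwo L' φ hφ ∘ₗ lTensor M (lTensor M ψ) =
      lTensor M (lTensor M ψ) ∘ₗ onFirstTwo L φ hφ := hom_ext₃ fun l x => by
    simp only [LinearMap.comp_apply, onFirstTwo_assocAux, lTensor_lTensor_assocAux]
  exact LinearMap.congr_fun h x

theorem contractFirstTwo_natural (γ : BTensor A M M →ₗ[A] A)
    (hγ : ∀ (a : A) x, γ (MulOpposite.op a • x) = γ x * a) (ψ : L →ₗ[A] L')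
    (x : BTensor A M (BTensor A M L)) :
    contractFirstTwo L' γ hγ (lTensor M (lTensor M ψ) x) = ψ (contractFirstTwo L γ hγ x) := by
  have h : contractFirstTwo L' γ hγ ∘ₗ lTensor M (lTensor M ψ) =
      ψ ∘ₗ contractFirstTwo L γ hγ := hom_ext₃ fun l x => by
    simp only [LinearMap.comp_apply, contractFirstTwo_assocAux, lTensor_lTensor_assocAux, map_smul]
  exact LinearMap.congr_fun h x

theorem hom_ext₄ {P : Type u} [AddCommGroup P] [Module A P]
    {φ ψ : BTensor A M (BTensor A M (BTensor A M L)) →ₗ[A] P}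
    (h : ∀ (l : L) (x : BTensor A M (BTensor A M M)),
      φ (lTensor M (lTensor M (tmulRight l)) x) = ψ (lTensor M (lTensor M (tmulRight l)) x)) :
    φ = ψ := by
  refine hom_ext fun m y => ?_
  induction y using tensor_induction with
  | h0 => simp only [tmul_zero, map_zero]
  | ht n z =>
    induction z using tensor_induction with
    | h0 => simp only [tmul_zero, map_zero]
    | ht p l => exact h l (tmul A m (tmul A n p))
    | ha x y hx hy => simp only [tmul_add, map_add, hx, hy]
  | ha x y hx hy => simp only [tmul_add, map_add, hx, hy]

end Functoriality

/-! ### Braid and metric identities with an arbitrary left module as last tensor factor. -/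

section BraidingMetric

variable {A : Type u} [Ring A] [Algebra ℂ A]
variable {Γ : Type u} [AddCommGroup Γ] [Module ℂ Γ] [Module A Γ] [Module Aᵐᵒᵖ Γ]
  [SMulCommClass A Aᵐᵒᵖ Γ] [IsScalarTower ℂ A Γ] [IsScalarTower ℂ Aᵐᵒᵖ Γ]
variable {L : Type u} [AddCommGroup L] [Module ℂ L] [Module A L] [IsScalarTower ℂ A L]
variable {L' : Type u} [AddCommGroup L'] [Module ℂ L'] [Module A L'] [IsScalarTower ℂ A L']

namespace Braiding

variable (σ : Braiding A Γ)

theorem hom₁₂_assocAux (l : L) (x : BTensor A Γ Γ) :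
    σ.hom₁₂ L (assocAux L l x) = assocAux L l (σ.hom x) := onFirstTwo_assocAux _ _ l x

theorem inv₁₂_assocAux (l : L) (x : BTensor A Γ Γ) :
    σ.inv₁₂ L (assocAux L l x) = assocAux L l (σ.inv x) := onFirstTwo_assocAux _ _ l x

theorem hom_inv (x : BTensor A Γ Γ) : σ.hom (σ.inv x) = x := σ.toEquiv.apply_symm_apply x

theorem hom₁₂_inv₁₂ (x : BTensor A Γ (BTensor A Γ L)) : σ.hom₁₂ L (σ.inv₁₂ L x) = x := by
  have h : σ.hom₁₂ L ∘ₗ σ.inv₁₂ L = LinearMap.id := hom_ext₃ fun l x => by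
    simp only [LinearMap.comp_apply, inv₁₂_assocAux, hom₁₂_assocAux, hom_inv, LinearMap.id_apply]
  exact LinearMap.congr_fun h x

theorem inv_hom (x : BTensor A Γ Γ) : σ.inv (σ.hom x) = x := σ.toEquiv.symm_apply_apply x

theorem inv₁₂_hom₁₂ (x : BTensor A Γ (BTensor A Γ L)) : σ.inv₁₂ L (σ.hom₁₂ L x) = x := by
  have h : σ.inv₁₂ L ∘ₗ σ.hom₁₂ L = LinearMap.id := hom_ext₃ fun l x => by
    simp only [LinearMap.comp_apply, inv₁₂_assocAux, hom₁₂_assocAux, inv_hom, LinearMap.id_apply]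
  exact LinearMap.congr_fun h x

theorem hom₁₂_natural (ψ : L →ₗ[A] L') (x : BTensor A Γ (BTensor A Γ L)) :
    σ.hom₁₂ L' (lTensor Γ (lTensor Γ ψ) x) = lTensor Γ (lTensor Γ ψ) (σ.hom₁₂ L x) :=
  onFirstTwo_natural _ _ ψ x

theorem inv₁₂_natural (ψ : L →ₗ[A] L') (x : BTensor A Γ (BTensor A Γ L)) :
    σ.inv₁₂ L' (lTensor Γ (lTensor Γ ψ) x) = lTensor Γ (lTensor Γ ψ) (σ.inv₁₂ L x) :=
  onFirstTwo_natural _ _ ψ x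

theorem lTensor_hom₁₂_tmulRight (l : L) (x : BTensor A Γ (BTensor A Γ Γ)) :
    lTensor Γ (σ.hom₁₂ L) (lTensor Γ (lTensor Γ (tmulRight l)) x) =
      lTensor Γ (lTensor Γ (tmulRight l)) (lTensor Γ σ.hom x) := by
  rw [lTensor_comp_apply, lTensor_comp_apply]
  congr 2
  ext y
  simp only [LinearMap.comp_apply, ← assocAux_eq_lTensor, hom₁₂_assocAux]

theorem lTensor_inv₁₂_tmulRight (l : L) (x : BTensor A Γ (BTensor A Γ Γ)) :
    lTensor Γ (σ.inv₁₂ L) (lTensor Γ (lTensor Γ (tmulRight l)) x) =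
      lTensor Γ (lTensor Γ (tmulRight l)) (lTensor Γ σ.inv x) := by
  rw [lTensor_comp_apply, lTensor_comp_apply]
  congr 2
  ext y
  simp only [LinearMap.comp_apply, ← assocAux_eq_lTensor, inv₁₂_assocAux]

/-- For each l, the map - ⊗ l on Γ^{⊗3} intertwines the operators on both sides with those in
`Braiding.braid`, and the images of these maps span. -/
theorem braid_tensor (L : Type u) [AddCommGroup L] [Module ℂ L] [Module A L]
    [IsScalarTower ℂ A L] :
    σ.hom₁₂ (BTensor A Γ L) ∘ₗ lTensor Γ (σ.hom₁₂ L) ∘ₗ σ.hom₁₂ (BTensor A Γ L) =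
      lTensor Γ (σ.hom₁₂ L) ∘ₗ σ.hom₁₂ (BTensor A Γ L) ∘ₗ lTensor Γ (σ.hom₁₂ L) :=
  hom_ext₄ fun l x => by
    simp only [LinearMap.comp_apply, hom₁₂_natural, lTensor_hom₁₂_tmulRight]
    exact congrArg _ (LinearMap.congr_fun σ.braid x)

end Braiding

namespace SigmaMetric

variable {σ : Braiding A Γ} (g : SigmaMetric σ)

/-- `g₁₂` on `Γ ⊗ (Γ ⊗ L)`. -/
noncomputable def hom₁₂ (L : Type u) [AddCommGroup L] [Module ℂ L] [Module A L]
    [IsScalarTower ℂ A L] : BTensor A Γ (BTensor A Γ L) →ₗ[A] L :=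
  contractFirstTwo L g.hom g.map_op_smul

theorem hom₁₂_assocAux (l : L) (x : BTensor A Γ Γ) :
    g.hom₁₂ L (assocAux L l x) = g.hom x • l := contractFirstTwo_assocAux _ _ l x

theorem hom₁₂_natural (ψ : L →ₗ[A] L') (x : BTensor A Γ (BTensor A Γ L)) :
    g.hom₁₂ L' (lTensor Γ (lTensor Γ ψ) x) = ψ (g.hom₁₂ L x) :=
  contractFirstTwo_natural _ _ ψ x

theorem lTensor_hom₁₂_tmulRight (l : L) (x : BTensor A Γ (BTensor A Γ Γ)) :
    lTensor Γ (g.hom₁₂ L) (lTensor Γ (lTensor Γ (tmulRight l)) x) =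
      tmulRight l (contractLastTwo g.hom x) := by
  rw [lTensor_comp_apply, ← LinearMap.comp_apply]
  refine LinearMap.congr_fun (hom_ext fun m y => ?_) x
  simp only [LinearMap.comp_apply, lTensor_tmul, ← assocAux_eq_lTensor, hom₁₂_assocAux]
  exact (op_smul_tmul A _ _ _).symm

theorem compat_tensor (x : BTensor A Γ (BTensor A Γ (BTensor A Γ L))) :
    g.hom₁₂ (BTensor A Γ L) (lTensor Γ (σ.hom₁₂ L) (σ.hom₁₂ (BTensor A Γ L) x)) =
      lTensor Γ (g.hom₁₂ L) x := by
  have h : g.hom₁₂ (BTensor A Γ L) ∘ₗ lTensor Γ (σ.hom₁₂ L) ∘ₗ σ.hom₁₂ (BTensor A Γ L) =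
      lTensor Γ (g.hom₁₂ L) := hom_ext₄ fun l x => by
    simp only [LinearMap.comp_apply, Braiding.hom₁₂_natural, Braiding.lTensor_hom₁₂_tmulRight,
      hom₁₂_natural, lTensor_hom₁₂_tmulRight]
    exact congrArg _ (LinearMap.congr_fun g.compat x)
  exact LinearMap.congr_fun h x

theorem compat_inv_tensor (x : BTensor A Γ (BTensor A Γ (BTensor A Γ L))) :
    g.hom₁₂ (BTensor A Γ L) (lTensor Γ (σ.inv₁₂ L) (σ.inv₁₂ (BTensor A Γ L) x)) =
      lTensor Γ (g.hom₁₂ L) x := by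
  have h : g.hom₁₂ (BTensor A Γ L) ∘ₗ lTensor Γ (σ.inv₁₂ L) ∘ₗ σ.inv₁₂ (BTensor A Γ L) =
      lTensor Γ (g.hom₁₂ L) := hom_ext₄ fun l x => by
    simp only [LinearMap.comp_apply, Braiding.inv₁₂_natural, Braiding.lTensor_inv₁₂_tmulRight,
      hom₁₂_natural, lTensor_hom₁₂_tmulRight]
    exact congrArg _ (LinearMap.congr_fun g.compat_inv x)
  exact LinearMap.congr_fun h x

end SigmaMetric

end BraidingMetric

/-! ## Antisymmetrizers and contractions on the tensor powers -/

section Powers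

variable {A : Type u} [Ring A] [Algebra ℂ A]
variable {Γ : Type u} [AddCommGroup Γ] [Module ℂ Γ] [Module A Γ] [Module Aᵐᵒᵖ Γ]
  [SMulCommClass A Aᵐᵒᵖ Γ] [IsScalarTower ℂ A Γ] [IsScalarTower ℂ Aᵐᵒᵖ Γ]
variable (σ : Braiding A Γ)

theorem braidAt_succ (k i : ℕ) :
    braidAt σ (k + 1) (i + 1) = lTensorHom Γ (TPow A Γ k) (braidAt σ k i) := by
  cases k <;> rfl

theorem braidAt_one_zero : braidAt σ 1 0 = 1 := rfl

theorem braidAt_comm (k i j : ℕ) (hij : i + 2 ≤ j) :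
    braidAt σ k i * braidAt σ k j = braidAt σ k j * braidAt σ k i := by
  induction k generalizing i j with
  | zero => rfl
  | succ k ih =>
    obtain ⟨j, rfl⟩ : ∃ l, j = l + 1 := ⟨j - 1, by omega⟩
    rcases i with _ | i
    · rcases k with _ | k
      · rw [zero_add, braidAt_one_zero, one_mul, mul_one]
      · obtain ⟨j, rfl⟩ : ∃ l, j = l + 1 := ⟨j - 1, by omega⟩
        rw [braidAt_succ, braidAt_succ]
        exact LinearMap.ext fun x => σ.hom₁₂_natural (braidAt σ k j) x
    · rw [braidAt_succ, braidAt_succ, ← map_mul, ih i j (by omega), map_mul]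

theorem braidAt_braid (k i : ℕ) (hi : i + 3 ≤ k) :
    braidAt σ k i * braidAt σ k (i + 1) * braidAt σ k i =
      braidAt σ k (i + 1) * braidAt σ k i * braidAt σ k (i + 1) := by
  induction k generalizing i with
  | zero => omega
  | succ k ih =>
    rcases i with _ | i
    · obtain ⟨k, rfl⟩ : ∃ l, k = l + 2 := ⟨k - 2, by omega⟩
      rw [mul_assoc, mul_assoc]
      exact σ.braid_tensor (TPow A Γ k)
    · simp only [braidAt_succ, ← map_mul]
      rw [ih i (by omega)]

/-- The operators `-σ_{i+1,i+2}` on `Γ^{⊗k}`. -/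
noncomputable def negBraid (k i : ℕ) : Module.End A (TPow A Γ k) := -braidAt σ k i

/-- Outside the range of strands `braidAt` is the identity, so distant commutation needs no bound,
whereas the braid relation would fail at the boundary. Both sides of the cubic relation acquire the
same sign. -/
theorem isBraid_negBraid (k : ℕ) : BraidRing.IsBraid (negBraid σ k) k where
  comm i j hij := by simpa [negBraid] using braidAt_comm σ k i j hij
  braid i hi := by simpa [negBraid] using braidAt_braid σ k i hi

theorem lTensorHom_negBraid (k i : ℕ) :
    lTensorHom Γ (TPow A Γ k) (negBraid σ k i) = negBraid σ (k + 1) (i + 1) := by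
  rw [negBraid, negBraid, braidAt_succ]
  exact map_neg _ _

theorem negOnePow_smul_braidWord (k : ℕ) (w : List ℕ) :
    (-1 : ℤ) ^ w.length • braidWord σ k w = (w.map (negBraid σ k)).prod := by
  induction w with
  | nil => simp [braidWord]
  | cons i w ih =>
    rw [List.map_cons, List.prod_cons, ← ih, negBraid, braidWord, braidWord, List.map_cons,
      List.prod_cons, List.length_cons, pow_succ', neg_one_mul, neg_smul, mul_smul_comm, neg_mul]
    exact (smul_neg _ _).symm

theorem shuffle_eq_sumUp (l : ℕ) :
    shuffle σ (l + 1) = BraidRing.sumUp (negBraid σ (l + 1)) 0 l := by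
  rw [BraidRing.sumUp_eq_sum, shuffle]
  refine Finset.sum_congr rfl fun j _ => ?_
  rw [← negOnePow_smul_braidWord, List.length_range]

theorem lTensorHom_braidWord (k : ℕ) (w : List ℕ) :
    lTensorHom Γ (TPow A Γ k) (braidWord σ k w) = braidWord σ (k + 1) (w.map (· + 1)) := by
  rw [braidWord, braidWord, map_list_prod, List.map_map, List.map_map]
  congr 1
  refine List.map_congr_left fun i _ => ?_
  exact (braidAt_succ σ k i).symm

/-- Permutations of `k + 1` letters as products `u s_0 ⋯ s_{j-1}` with `u` fixing `0`. -/
noncomputable def permSuccEquiv (k : ℕ) :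
    Fin (k + 1) × Equiv.Perm (Fin k) ≃ Equiv.Perm (Fin (k + 1)) where
  toFun p := Equiv.Perm.decomposeFin.symm (0, p.2) * Fin.cycleRange p.1
  invFun w := (w.symm 0, (Equiv.Perm.decomposeFin (w * (Fin.cycleRange (w.symm 0))⁻¹)).2)
  left_inv := by
    rintro ⟨j, u⟩
    have h0 : (Equiv.Perm.decomposeFin.symm (0, u) * Fin.cycleRange j).symm 0 = j := by
      rw [Equiv.symm_apply_eq, Equiv.Perm.mul_apply, Fin.cycleRange_self]
      simp [Equiv.Perm.decomposeFin_symm_apply_zero]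
    simp only [h0, mul_inv_cancel_right, Equiv.apply_symm_apply]
  right_inv w := by
    have h0 : (w * (Fin.cycleRange (w.symm 0))⁻¹) 0 = 0 := by
      have : (Fin.cycleRange (w.symm 0))⁻¹ 0 = w.symm 0 := by
        rw [Equiv.Perm.inv_eq_iff_eq, Fin.cycleRange_self]
      rw [Equiv.Perm.mul_apply, this, Equiv.apply_symm_apply]
    obtain ⟨⟨p, u⟩, hp⟩ := Equiv.Perm.decomposeFin.symm.surjective
      (w * (Fin.cycleRange (w.symm 0))⁻¹)
    rw [← hp, Equiv.Perm.decomposeFin_symm_apply_zero] at h0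
    subst h0
    simp only [← hp, Equiv.apply_symm_apply]
    rw [hp, inv_mul_cancel_right]

/-- The sum is reindexed by the coset decomposition w = u s_0 ⋯ s_{j-1}, along which both the chosen
word and the sign factor. No independence of the reduced expression is needed. -/
theorem antisymmetrizer_succ (k : ℕ) :
    antisymmetrizer σ (k + 1) =
      lTensorHom Γ (TPow A Γ k) (antisymmetrizer σ k) * shuffle σ (k + 1) := by
  rw [antisymmetrizer, ← (permSuccEquiv k).sum_comp, Fintype.sum_prod_type_right, antisymmetrizer,
    shuffle, map_sum, Finset.sum_mul]
  refine Finset.sum_congr rfl fun u _ => ?_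
  rw [Finset.mul_sum, ← Fin.sum_univ_eq_sum_range
    (fun j => lTensorHom Γ (TPow A Γ k) ((Equiv.Perm.sign u : ℤ) • braidWord σ k (reducedWord k u)) *
      ((-1 : ℤ) ^ j • braidWord σ (k + 1) (List.range j)))]
  refine Finset.sum_congr rfl fun j _ => ?_
  -- `reducedWord` decomposes a permutation by the inverse of `permSuccEquiv`, so the pair (j, u) is
  -- recovered.
  have hw : reducedWord (k + 1) (permSuccEquiv k (j, u)) =
      (reducedWord k u).map (· + 1) ++ List.range j := by
    have h := (permSuccEquiv k).symm_apply_apply (j, u)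
    rw [reducedWord]
    change (reducedWord k ((permSuccEquiv k).symm (permSuccEquiv k (j, u))).2).map (· + 1) ++
      List.range ((permSuccEquiv k).symm (permSuccEquiv k (j, u))).1 = _
    rw [h]
  have hs : (Equiv.Perm.sign (permSuccEquiv k (j, u)) : ℤ) =
      Equiv.Perm.sign u * (-1) ^ (j : ℕ) := by
    simp [permSuccEquiv, Equiv.Perm.decomposeFin.symm_sign, Fin.sign_cycleRange]
  rw [hw, hs, map_zsmul, lTensorHom_braidWord, smul_mul_smul_comm]
  congr 1
  rw [braidWord, braidWord, braidWord, List.map_append, List.prod_append]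

theorem antisymmetrizer_eq_sym (k : ℕ) :
    antisymmetrizer σ k = BraidRing.sym (negBraid σ k) 0 k := by
  induction k with
  | zero => simp [antisymmetrizer, BraidRing.sym, reducedWord, braidWord]
  | succ k ih =>
    rw [antisymmetrizer_succ, ih, BraidRing.map_sym _ _ (lTensorHom_negBraid σ k),
      shuffle_eq_sumUp, BraidRing.sym]

theorem antisymmetrizer_zero_apply (x : TPow A Γ 0) : antisymmetrizer σ 0 x = x := by
  rw [antisymmetrizer_eq_sym]; rfl

theorem antisymmetrizer_one_apply (x : TPow A Γ 1) : antisymmetrizer σ 1 x = x := by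
  rw [antisymmetrizer_eq_sym]; simp [BraidRing.sym, BraidRing.sumUp]

theorem antisymmetrizer_tmul (k : ℕ) (x : TPow A Γ k) (hx : antisymmetrizer σ k x = 0) (ω : Γ) :
    antisymmetrizer σ (k + 1) (tmul A ω x) = 0 := by
  rw [antisymmetrizer_eq_sym,
    BraidRing.sym_succ_eq_sumDown_mul (isBraid_negBraid σ (k + 1)) 0 k (by omega),
    ← BraidRing.map_sym _ _ (lTensorHom_negBraid σ k), ← antisymmetrizer_eq_sym,
    Module.End.mul_apply]
  rw [lTensorHom_tmul, hx, tmul_zero, map_zero]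

/-- Multiplication `x ↦ x ⊗ y` by `y ∈ Γ^{⊗j}` from the right. -/
noncomputable def mulTail {j : ℕ} (y : TPow A Γ j) : (k : ℕ) → (TPow A Γ k →ₗ[A] TPow A Γ (j + k))
  | 0 => LinearMap.toSpanSingleton A (TPow A Γ j) y
  | k + 1 => lTensor Γ (mulTail y k)

theorem braidAt_mulTail {j : ℕ} (y : TPow A Γ j) (k i : ℕ) (hi : i + 2 ≤ k) (x : TPow A Γ k) :
    braidAt σ (j + k) i (mulTail y k x) = mulTail y k (braidAt σ k i x) := by
  induction k generalizing i with
  | zero => omega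
  | succ k ih =>
    rcases i with _ | i
    · obtain ⟨k, rfl⟩ : ∃ l, k = l + 1 := ⟨k - 1, by omega⟩
      exact σ.hom₁₂_natural (mulTail y k) x
    · change braidAt σ (j + k + 1) (i + 1) _ = _
      rw [braidAt_succ, braidAt_succ, lTensorHom_apply, lTensorHom_apply]
      change lTensor Γ _ (lTensor Γ _ x) = lTensor Γ _ (lTensor Γ _ x)
      rw [lTensor_comp_apply, lTensor_comp_apply]
      congr 2
      ext z
      exact ih i (by omega) z

theorem sym_mulTail {j : ℕ} (y : TPow A Γ j) (k m n : ℕ) (hn : m + n ≤ k) (x : TPow A Γ k) :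
    BraidRing.sym (negBraid σ (j + k)) m n (mulTail y k x) =
      mulTail y k (BraidRing.sym (negBraid σ k) m n x) := by
  have hs : ∀ (n m : ℕ) (x : TPow A Γ k), m + n + 1 ≤ k →
      BraidRing.sumUp (negBraid σ (j + k)) m n (mulTail y k x) =
        mulTail y k (BraidRing.sumUp (negBraid σ k) m n x) := by
    intro n
    induction n with
    | zero => intro m x _; rfl
    | succ n ih =>
      intro m x h
      simp only [BraidRing.sumUp, LinearMap.add_apply, Module.End.mul_apply, Module.End.one_apply,
        map_add, ih (m + 1) x (by omega), negBraid, LinearMap.neg_apply, map_neg,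
        braidAt_mulTail σ y k m (by omega)]
  induction n generalizing m x with
  | zero => rfl
  | succ n ih =>
    simp only [BraidRing.sym, Module.End.mul_apply]
    rw [hs n m x (by omega), ih (m + 1) (by omega)]

theorem antisymmetrizer_mulTail {j : ℕ} (y : TPow A Γ j) (k : ℕ) (x : TPow A Γ k)
    (hx : antisymmetrizer σ k x = 0) : antisymmetrizer σ (j + k) (mulTail y k x) = 0 := by
  -- A_{j+k} = z (A_k ⊗ id).
  obtain ⟨z, hz⟩ := BraidRing.exists_sym_eq_mul_sym (isBraid_negBraid σ (j + k)) j k le_rfl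
  rw [antisymmetrizer_eq_sym, hz, Module.End.mul_apply, sym_mulTail σ y k 0 k (by omega),
    ← antisymmetrizer_eq_sym, hx, map_zero, map_zero]

theorem antisymmetrizer_assocAux (k : ℕ) (x : TPow A Γ k) (ρ : BTensor A Γ Γ)
    (hρ : σ.hom ρ = ρ) : antisymmetrizer σ (k + 2) (assocAux (TPow A Γ k) x ρ) = 0 := by
  obtain ⟨z, hz⟩ := BraidRing.exists_sym_eq_mul_sym (isBraid_negBraid σ (k + 2)) k 2 le_rfl
  rw [antisymmetrizer_eq_sym, hz, Module.End.mul_apply, BraidRing.sym_zero_two]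
  have h : (1 + negBraid σ (k + 2) 0) (assocAux (TPow A Γ k) x ρ) = 0 := by
    change assocAux (TPow A Γ k) x ρ + -(σ.hom₁₂ (TPow A Γ k) (assocAux (TPow A Γ k) x ρ)) = 0
    rw [σ.hom₁₂_assocAux, hρ, add_neg_cancel]
  rw [h, map_zero]

theorem shuffle_one : shuffle σ 1 = 1 := by
  rw [shuffle_eq_sumUp]; rfl

theorem shuffle_tmul (l : ℕ) (ω : Γ) (x : TPow A Γ (l + 1)) :
    shuffle σ (l + 2) (tmul A ω x) =
      tmul A ω x - σ.hom₁₂ (TPow A Γ l) (tmul A ω (shuffle σ (l + 1) x)) := by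
  rw [shuffle_eq_sumUp, BraidRing.sumUp, ← BraidRing.map_sumUp _ _ (lTensorHom_negBraid σ (l + 1)),
    ← shuffle_eq_sumUp, sub_eq_add_neg]
  rfl

/-! ### Contractions: descent to the quotient and the anticommutation identities. -/

section Contraction

variable {σ} (g : SigmaMetric σ)

theorem contraction_tmul (l : ℕ) (ω : Γ) (x : TPow A Γ (l + 1)) :
    contraction g l (tmul A ω x) = g.hom₁₂ (TPow A Γ l) (tmul A ω (shuffle σ (l + 1) x)) := rfl

/-- By naturality g₁₂ commutes with A_l acting behind the first two factors, and id ⊗ A_l completes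
the shuffle to A_{l+1}. -/
theorem antisymmetrizer_contraction (l : ℕ) (ω : Γ) (x : TPow A Γ (l + 1)) :
    antisymmetrizer σ l (contraction g l (tmul A ω x)) =
      g.hom₁₂ (TPow A Γ l) (tmul A ω (antisymmetrizer σ (l + 1) x)) := by
  rw [contraction_tmul, ← g.hom₁₂_natural, antisymmetrizer_succ]
  rfl

theorem tmul_contraction_add (l : ℕ) (ω η : Γ) (x : TPow A Γ (l + 1)) :
    tmul A ω (contraction g l (tmul A η x)) + contraction g (l + 1) (tmul A ω (tmul A η x)) =
      g.hom (tmul A ω η) • x +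
        g.hom₁₂ (TPow A Γ (l + 1)) (lTensor Γ (σ.hom₁₂ (TPow A Γ l))
          (assocAux (TPow A Γ (l + 1)) (shuffle σ (l + 1) x)
            (σ.hom (tmul A ω η) - tmul A ω η))) := by
  -- This writes ω ⊗ ⟨η, x⟩ as g₁₂σ₂₃σ₁₂, to be compared with the term -g₁₂σ₂₃ that comes from the
  -- recursion for the shuffle of η ⊗ x.
  have h := g.compat_tensor (tmul A ω (tmul A η (shuffle σ (l + 1) x)))
  have h' := σ.hom₁₂_assocAux (shuffle σ (l + 1) x) (tmul A ω η)
  rw [assocAux_tmul] at h'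
  rw [h', lTensor_tmul] at h
  have h'' := g.hom₁₂_assocAux x (tmul A ω η)
  rw [assocAux_tmul] at h''
  rw [contraction_tmul, contraction_tmul, shuffle_tmul, map_sub (assocAux _ _), map_sub, map_sub,
    tmul_sub, map_sub, h'', assocAux_tmul, lTensor_tmul]
  rw [← h]
  abel

/-- Both sides equal g₁₂g₁₂σ₂₃⁻¹: on the left g₂₃σ₃₄ = g₃₄σ₂₃⁻¹ by one compatibility of the metric,
on the right g₂₃σ₁₂ = g₁₂σ₂₃⁻¹ by the other. -/
theorem hom₁₂_lTensor_hom₁₂_braid {L : Type u} [AddCommGroup L] [Module ℂ L] [Module A L]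
    [IsScalarTower ℂ A L] (x : BTensor A Γ (BTensor A Γ (BTensor A Γ (BTensor A Γ L)))) :
    g.hom₁₂ L (lTensor Γ (g.hom₁₂ (BTensor A Γ L)) (lTensor Γ (lTensor Γ (σ.hom₁₂ L)) x)) =
      g.hom₁₂ L (lTensor Γ (g.hom₁₂ (BTensor A Γ L))
        (σ.hom₁₂ (BTensor A Γ (BTensor A Γ L)) x)) := by
  have h1 : g.hom₁₂ (BTensor A Γ L) ∘ₗ lTensor Γ (σ.hom₁₂ L) =
      lTensor Γ (g.hom₁₂ L) ∘ₗ σ.inv₁₂ (BTensor A Γ L) := by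
    ext y
    simp only [LinearMap.comp_apply]
    rw [← g.compat_tensor, σ.hom₁₂_inv₁₂]
  rw [← g.compat_inv_tensor (σ.hom₁₂ _ x), σ.inv₁₂_hom₁₂, lTensor_comp_apply, h1, ← lTensor_comp_apply,
    g.hom₁₂_natural]

/-- The map `Γ ⊗ Γ ⊗ Γ^{⊗(l+2)} → Γ^{⊗l}`, `ω ⊗ η ⊗ x ↦ ⟨ω, ⟨η, x⟩⟩`, in the first two factors. -/
noncomputable def contractionTwice (l : ℕ) (x : TPow A Γ (l + 2)) :
    BTensor A Γ Γ →ₗ[A] TPow A Γ l :=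
  contraction g l ∘ₗ lTensor Γ (contraction g (l + 1)) ∘ₗ assocAux (TPow A Γ (l + 2)) x

theorem contractionTwice_tmul (l : ℕ) (x : TPow A Γ (l + 2)) (ω η : Γ) :
    contractionTwice g l x (tmul A ω η) =
      contraction g l (tmul A ω (contraction g (l + 1) (tmul A η x))) := rfl

theorem antisymmetrizer_contractionTwice_apply (l : ℕ) (x : TPow A Γ (l + 2))
    (ρ : BTensor A Γ Γ) :
    antisymmetrizer σ l (contractionTwice g l x ρ) =
      g.hom₁₂ (TPow A Γ l) (lTensor Γ (g.hom₁₂ (TPow A Γ (l + 1)))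
        (assocAux (TPow A Γ (l + 2)) (antisymmetrizer σ (l + 2) x) ρ)) := by
  induction ρ using tensor_induction with
  | h0 => simp only [map_zero]
  | ht ω η =>
    rw [contractionTwice_tmul, antisymmetrizer_contraction, antisymmetrizer_contraction]
    rfl
  | ha x y hx hy => simp only [map_add, hx, hy]

theorem antisymmetrizer_contractionTwice (l : ℕ) (x : TPow A Γ (l + 2)) (ρ : BTensor A Γ Γ)
    (hρ : σ.hom ρ = ρ) : antisymmetrizer σ l (contractionTwice g l x ρ) = 0 := by
  -- A_{l+2} = (1 - σ₁₂) z; the σ₁₂ acting on z x becomes σ acting on ρ, where it is trivial.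
  obtain ⟨z, hz⟩ := BraidRing.exists_sym_eq_sym_mul (isBraid_negBraid σ (l + 2)) l 2 le_rfl
  rw [antisymmetrizer_contractionTwice_apply, antisymmetrizer_eq_sym, hz, BraidRing.sym_zero_two,
    Module.End.mul_apply]
  generalize z x = y
  have h : (1 + negBraid σ (l + 2) 0) y = y - σ.hom₁₂ (TPow A Γ l) y := (sub_eq_add_neg _ _).symm
  have h' := hom₁₂_lTensor_hom₁₂_braid g (assocAux (TPow A Γ (l + 2)) y ρ)
  rw [lTensor_lTensor_assocAux, σ.hom₁₂_assocAux, hρ] at h'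
  rw [h, assocAux_sub, map_sub, map_sub]
  exact sub_eq_zero.2 h'.symm

end Contraction

end Powers

/-! ## The tensor algebra, and the graded model of the exterior algebra -/

section Model

variable {A : Type u} [Ring A] [Algebra ℂ A]
variable {Γ : Type u} [AddCommGroup Γ] [Module ℂ Γ] [Module A Γ] [Module Aᵐᵒᵖ Γ]
  [SMulCommClass A Aᵐᵒᵖ Γ] [IsScalarTower ℂ A Γ] [IsScalarTower ℂ Aᵐᵒᵖ Γ]

namespace TAlg

section Lift

variable {R : Type*} [Semiring R] [Algebra ℂ R] (f : A →ₐ[ℂ] R) (h : Γ →ₗ[ℂ] R)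
  (hl : ∀ (a : A) (ω : Γ), h (a • ω) = f a * h ω)
  (hr : ∀ (a : A) (ω : Γ), h (MulOpposite.op a • ω) = h ω * f a)

/-- The universal property of the tensor algebra. -/
noncomputable def liftHom : TAlg A Γ →ₐ[ℂ] R :=
  RingQuot.liftAlgHom ℂ ⟨TensorAlgebra.lift ℂ (f.toLinearMap.coprod h), fun x y hxy => by
    induction hxy with
    | one => simp
    | mul a b => simp
    | left a ω => simp [hl]
    | right a ω => simp [hr]⟩

theorem liftHom_ofA (a : A) : liftHom f h hl hr (ofA A Γ a) = f a := by
  change RingQuot.liftAlgHom ℂ _ (RingQuot.mkAlgHom ℂ (TRel A Γ) (TensorAlgebra.ι ℂ (a, 0))) = _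
  rw [RingQuot.liftAlgHom_mkAlgHom_apply, TensorAlgebra.lift_ι_apply]
  simp

theorem liftHom_ι (ω : Γ) : liftHom f h hl hr (ι A Γ ω) = h ω := by
  change RingQuot.liftAlgHom ℂ _ (RingQuot.mkAlgHom ℂ (TRel A Γ) (TensorAlgebra.ι ℂ (0, ω))) = _
  rw [RingQuot.liftAlgHom_mkAlgHom_apply, TensorAlgebra.lift_ι_apply]
  simp

end Lift

theorem induction_gen {p : TAlg A Γ → Prop} (hA : ∀ a, p (ofA A Γ a)) (hΓ : ∀ ω, p (ι A Γ ω))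
    (hadd : ∀ x y, p x → p y → p (x + y)) (hmul : ∀ x y, p x → p y → p (x * y))
    (x : TAlg A Γ) : p x := by
  obtain ⟨y, rfl⟩ : ∃ y, mk A Γ y = x := RingQuot.mkAlgHom_surjective ℂ _ x
  induction y using TensorAlgebra.induction with
  | algebraMap c =>
    rw [AlgHom.commutes, ← AlgHom.commutes (ofA A Γ)]
    exact hA _
  | ι v =>
    have : mk A Γ (TensorAlgebra.ι ℂ v) = ofA A Γ v.1 + ι A Γ v.2 := by
      change _ = mk A Γ (TensorAlgebra.ι ℂ (v.1, 0)) + mk A Γ (TensorAlgebra.ι ℂ (0, v.2))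
      rw [← map_add, ← map_add]
      simp
    rw [this]
    exact hadd _ _ (hA _) (hΓ _)
  | mul x y hx hy => rw [map_mul]; exact hmul _ _ hx hy
  | add x y hx hy => rw [map_add]; exact hadd _ _ hx hy

theorem ofTPow_tmul (k : ℕ) (ω : Γ) (x : TPow A Γ k) :
    ofTPow A Γ (k + 1) (tmul A ω x) = ι A Γ ω * ofTPow A Γ k x := rfl

theorem ofTPow_zero (a : A) : ofTPow A Γ 0 a = ofA A Γ a := rfl

theorem ofTwo_tmul (ω η : Γ) : ofTwo A Γ (tmul A ω η) = ι A Γ ω * ι A Γ η := rfl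

end TAlg

variable (σ : Braiding A Γ)

/-- The `ℂ`-linear map out of the quotient by an `A`-submodule induced by a `ℂ`-linear map. -/
noncomputable def quotientLift {V : Type*} [AddCommGroup V] [Module ℂ V] [Module A V]
    [IsScalarTower ℂ A V] {Z : Type*} [AddCommGroup Z] [Module ℂ Z] (p : Submodule A V)
    (f : V →ₗ[ℂ] Z) (hf : ∀ x ∈ p, f x = 0) : V ⧸ p →ₗ[ℂ] Z :=
  (p.restrictScalars ℂ).liftQ f hf ∘ₗ (Submodule.Quotient.restrictScalarsEquiv ℂ p).symm

theorem quotientLift_mk {V : Type*} [AddCommGroup V] [Module ℂ V] [Module A V]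
    [IsScalarTower ℂ A V] {Z : Type*} [AddCommGroup Z] [Module ℂ Z] (p : Submodule A V)
    (f : V →ₗ[ℂ] Z) (hf : ∀ x ∈ p, f x = 0) (x : V) :
    quotientLift p f hf (Submodule.Quotient.mk x) = f x := rfl

/-- `⨁ₖ Γ^{⊗k} / ker A_k`. -/
abbrev ExtModel : Type u := ⨁ k : ℕ, (TPow A Γ k ⧸ LinearMap.ker (antisymmetrizer σ k))

namespace ExtModel

/-- The canonical map `Γ^{⊗k} → ⨁ₖ Γ^{⊗k} / ker A_k`. -/
noncomputable def of (k : ℕ) : TPow A Γ k →ₗ[A] ExtModel σ :=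
  DirectSum.lof A ℕ (fun k => TPow A Γ k ⧸ LinearMap.ker (antisymmetrizer σ k)) k ∘ₗ
    Submodule.mkQ _

variable {σ}

theorem of_eq_zero_iff {k : ℕ} {x : TPow A Γ k} : of σ k x = 0 ↔ antisymmetrizer σ k x = 0 := by
  rw [of, LinearMap.comp_apply, DirectSum.lof_eq_of,
    map_eq_zero_iff _ (DirectSum.of_injective k)]
  simp

theorem induction_of {p : ExtModel σ → Prop} (hof : ∀ k x, p (of σ k x))
    (hadd : ∀ x y, p x → p y → p (x + y)) (m : ExtModel σ) : p m := by
  induction m using DirectSum.induction_on with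
  | zero => rw [← map_zero (of σ 0)]; exact hof 0 0
  | of k x =>
    obtain ⟨x, rfl⟩ := Submodule.mkQ_surjective _ x
    exact hof k x
  | add x y hx hy => exact hadd _ _ hx hy

/-- The component of degree `k`. -/
noncomputable def degree (k : ℕ) :
    ExtModel σ →ₗ[A] (TPow A Γ k ⧸ LinearMap.ker (antisymmetrizer σ k)) :=
  DirectSum.component A ℕ _ k

theorem degree_of_ne {i k : ℕ} (h : i ≠ k) (x : TPow A Γ i) : degree k (of σ i x) = 0 :=
  DirectSum.of_eq_of_ne _ _ _ h.symm

theorem degree_of_eq_zero_iff {k : ℕ} {x : TPow A Γ k} :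
    degree k (of σ k x) = 0 ↔ antisymmetrizer σ k x = 0 := by
  have h : degree k (of σ k x) = Submodule.Quotient.mk x := DirectSum.of_eq_same _ _
  rw [h, Submodule.Quotient.mk_eq_zero, LinearMap.mem_ker]

section Descend

variable {Z : Type*} [AddCommGroup Z] [Module ℂ Z] (f : ∀ k, TPow A Γ k →ₗ[ℂ] Z)
  (hf : ∀ k x, antisymmetrizer σ k x = 0 → f k x = 0)

/-- The linear map out of `⨁ₖ Γ^{⊗k} / ker A_k` given by linear maps on the `Γ^{⊗k}`. -/
noncomputable def descend : ExtModel σ →ₗ[ℂ] Z :=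
  DirectSum.toModule ℂ ℕ Z fun k =>
    quotientLift (LinearMap.ker (antisymmetrizer σ k)) (f k) fun x hx => hf k x hx

theorem descend_of (k : ℕ) (x : TPow A Γ k) : descend f hf (of σ k x) = f k x := by
  rw [descend, of, LinearMap.comp_apply, DirectSum.lof_eq_of, ← DirectSum.lof_eq_of ℂ,
    DirectSum.toModule_lof, Submodule.mkQ_apply, quotientLift_mk]

end Descend

theorem hom_ext_of {Z : Type*} [AddCommGroup Z] [Module ℂ Z] {φ ψ : ExtModel σ →ₗ[ℂ] Z}
    (h : ∀ k x, φ (of σ k x) = ψ (of σ k x)) : φ = ψ := by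
  refine LinearMap.ext fun m => ?_
  induction m using induction_of with
  | hof k x => exact h k x
  | hadd x y hx hy => rw [map_add, map_add, hx, hy]

variable (σ) in
/-- Left multiplication by `ω ∈ Γ`. -/
noncomputable def create : Γ →ₗ[ℂ] Module.End ℂ (ExtModel σ) :=
  (descend (Z := Γ →ₗ[ℂ] ExtModel σ)
    (fun k => ((tmulLin (A := A)).flip.compr₂ ((of σ (k + 1)).restrictScalars ℂ)))
    (fun k x hx => LinearMap.ext fun ω =>
      of_eq_zero_iff.2 (antisymmetrizer_tmul σ k x hx ω))).flip

theorem create_of (ω : Γ) (k : ℕ) (x : TPow A Γ k) :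
    create σ ω (of σ k x) = of σ (k + 1) (tmul A ω x) := by
  rw [create, LinearMap.flip_apply, descend_of]
  rfl

/-- The contraction by `ω ∈ Γ`. -/
noncomputable def annihilate (g : SigmaMetric σ) : Γ →ₗ[ℂ] Module.End ℂ (ExtModel σ) :=
  (descend (Z := Γ →ₗ[ℂ] ExtModel σ)
    (fun k => match k with
      | 0 => 0
      | k + 1 => (tmulLin (A := A)).flip.compr₂ ((of σ k ∘ₗ contraction g k).restrictScalars ℂ))
    (fun k x hx => LinearMap.ext fun ω => by
      rcases k with _ | k
      · rfl
      · refine of_eq_zero_iff.2 ((antisymmetrizer_contraction g k ω x).trans ?_)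
        rw [hx, tmul_zero, map_zero])).flip

variable (g : SigmaMetric σ)

theorem annihilate_of_zero (ω : Γ) (a : A) : annihilate g ω (of σ 0 a) = 0 := by
  rw [annihilate, LinearMap.flip_apply, descend_of]
  rfl

theorem annihilate_of_succ (ω : Γ) (k : ℕ) (x : TPow A Γ (k + 1)) :
    annihilate g ω (of σ (k + 1) x) = of σ k (contraction g k (tmul A ω x)) := by
  rw [annihilate, LinearMap.flip_apply, descend_of]
  rfl

variable (σ) in
/-- The action of `A`. -/
noncomputable def scalar : A →ₐ[ℂ] Module.End ℂ (ExtModel σ) := Algebra.lsmul ℂ ℂ (ExtModel σ)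

theorem scalar_of (a : A) (k : ℕ) (x : TPow A Γ k) : scalar σ a (of σ k x) = of σ k (a • x) :=
  ((of σ k).map_smul a x).symm

theorem create_smul (a : A) (ω : Γ) : create σ (a • ω) = scalar σ a * create σ ω :=
  hom_ext_of fun k x => by
    rw [Module.End.mul_apply, create_of, create_of, smul_tmul_left, scalar_of]

theorem create_op_smul (a : A) (ω : Γ) :
    create σ (MulOpposite.op a • ω) = create σ ω * scalar σ a :=
  hom_ext_of fun k x => by
    rw [Module.End.mul_apply, create_of, scalar_of, create_of, op_smul_tmul]

theorem annihilate_smul (a : A) (ω : Γ) :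
    annihilate g (a • ω) = scalar σ a * annihilate g ω :=
  hom_ext_of fun k x => by
    rw [Module.End.mul_apply]
    rcases k with _ | k
    · rw [annihilate_of_zero, annihilate_of_zero, map_zero]
    · rw [annihilate_of_succ, annihilate_of_succ, smul_tmul_left, map_smul, scalar_of]

theorem annihilate_op_smul (a : A) (ω : Γ) :
    annihilate g (MulOpposite.op a • ω) = annihilate g ω * scalar σ a :=
  hom_ext_of fun k x => by
    rw [Module.End.mul_apply, scalar_of]
    rcases k with _ | k
    · rw [annihilate_of_zero]; exact (annihilate_of_zero g ω (a • x)).symm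
    · rw [annihilate_of_succ, annihilate_of_succ, op_smul_tmul]

variable (σ) in
/-- The action of the tensor algebra by left multiplication. -/
noncomputable def tensorAction : TAlg A Γ →ₐ[ℂ] Module.End ℂ (ExtModel σ) :=
  TAlg.liftHom (scalar σ) (create σ) create_smul create_op_smul

/-- Identifies the action of a homogeneous tensor with concatenation, so that
`antisymmetrizer_mulTail` shows ker A_k to act by zero. -/
theorem tensorAction_ofTPow (k : ℕ) (x : TPow A Γ k) {j : ℕ} (y : TPow A Γ j) :
    tensorAction σ (TAlg.ofTPow A Γ k x) (of σ j y) = of σ (j + k) (mulTail y k x) := by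
  induction k with
  | zero =>
    rw [TAlg.ofTPow_zero, tensorAction, TAlg.liftHom_ofA, scalar_of]
    rfl
  | succ k ih =>
    induction x using tensor_induction with
    | h0 => simp only [map_zero, LinearMap.zero_apply]
    | ht ω x =>
      rw [TAlg.ofTPow_tmul, map_mul, Module.End.mul_apply, ih, tensorAction, TAlg.liftHom_ι,
        create_of]
      rfl
    | ha x x' hx hx' => simp only [map_add, LinearMap.add_apply, hx, hx']

theorem tensorAction_ofTPow_one (k : ℕ) (x : TPow A Γ k) :
    tensorAction σ (TAlg.ofTPow A Γ k x) (of σ 0 (1 : A)) = of σ k x := by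
  induction k with
  | zero =>
    rw [TAlg.ofTPow_zero, tensorAction, TAlg.liftHom_ofA, scalar_of]
    exact congrArg _ (mul_one (x : A))
  | succ k ih =>
    induction x using tensor_induction with
    | h0 => simp only [map_zero, LinearMap.zero_apply]
    | ht ω x =>
      rw [TAlg.ofTPow_tmul, map_mul, Module.End.mul_apply, ih, tensorAction, TAlg.liftHom_ι,
        create_of]
    | ha x x' hx hx' => simp only [map_add, LinearMap.add_apply, hx, hx']

variable (σ) in
/-- The action of the exterior algebra by left multiplication. -/
noncomputable def extAction : Ext σ →ₐ[ℂ] Module.End ℂ (ExtModel σ) :=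
  RingQuot.liftAlgHom ℂ ⟨tensorAction σ, fun x y hxy => by
    obtain ⟨k, x, hx⟩ := hxy
    rw [map_zero]
    refine hom_ext_of fun j y => ?_
    rw [tensorAction_ofTPow, LinearMap.zero_apply, of_eq_zero_iff]
    exact antisymmetrizer_mulTail σ y k x hx⟩

theorem extAction_mk (t : TAlg A Γ) : extAction σ (Ext.mk σ t) = tensorAction σ t :=
  RingQuot.liftAlgHom_mkAlgHom_apply ℂ _ _ _

variable (σ) in
/-- The canonical map from the model to the exterior algebra. -/
noncomputable def toExt : ExtModel σ →ₗ[ℂ] Ext σ :=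
  descend (Ext.ofTPow σ) fun k x hx => by
    have h : Ext.mk σ (TAlg.ofTPow A Γ k x) = Ext.mk σ 0 :=
      RingQuot.mkAlgHom_rel ℂ (ExtRel.ker k x hx)
    rwa [map_zero] at h

theorem toExt_of (k : ℕ) (x : TPow A Γ k) : toExt σ (of σ k x) = Ext.ofTPow σ k x :=
  descend_of _ _ k x

theorem toExt_scalar (a : A) (m : ExtModel σ) :
    toExt σ (scalar σ a m) = Ext.ofA σ a * toExt σ m := by
  induction m using induction_of with
  | hof k x =>
    rw [scalar_of, toExt_of, toExt_of, Ext.ofA, AlgHom.comp_apply]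
    change Ext.mk σ _ = _ * Ext.mk σ _
    rw [← map_mul]
    exact congrArg _ ((TAlg.ofTPow A Γ k).map_smul a x)
  | hadd x y hx hy => simp only [map_add, mul_add, hx, hy]

theorem toExt_create (ω : Γ) (m : ExtModel σ) :
    toExt σ (create σ ω m) = Ext.ι σ ω * toExt σ m := by
  induction m using induction_of with
  | hof k x =>
    rw [create_of, toExt_of, toExt_of]
    exact map_mul (Ext.mk σ) _ _
  | hadd x y hx hy => simp only [map_add, mul_add, hx, hy]

/-- It suffices to check the generators, where the model was built to match left multiplication.
Evaluated at 1, this gives one half of `equivExt`. -/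
theorem toExt_tensorAction (t : TAlg A Γ) (m : ExtModel σ) :
    toExt σ (tensorAction σ t m) = Ext.mk σ t * toExt σ m := by
  induction t using TAlg.induction_gen generalizing m with
  | hA a => rw [tensorAction, TAlg.liftHom_ofA, toExt_scalar]; rfl
  | hΓ ω => rw [tensorAction, TAlg.liftHom_ι, toExt_create]; rfl
  | hadd x y hx hy => simp only [map_add, LinearMap.add_apply, add_mul, hx, hy]
  | hmul x y hx hy => rw [map_mul, Module.End.mul_apply, hx, hy, map_mul, mul_assoc]

theorem toExt_one : toExt σ (of σ 0 (1 : A)) = 1 := by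
  rw [toExt_of]
  exact map_one (Ext.ofA σ)

theorem mk_surjective : Function.Surjective (Ext.mk σ) := RingQuot.mkAlgHom_surjective ℂ _

variable (σ) in
/-- The exterior algebra is `⨁ₖ Γ^{⊗k} / ker A_k`. -/
noncomputable def equivExt : ExtModel σ ≃ₗ[ℂ] Ext σ :=
  LinearEquiv.ofLinearMap (toExt σ)
    -- The inverse lets an exterior element act on the vacuum 1 of the model.
    ((LinearMap.applyₗ (of σ 0 (1 : A))) ∘ₗ (extAction σ).toLinearMap)
    (LinearMap.ext fun ρ => by
      obtain ⟨t, rfl⟩ := mk_surjective ρ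
      change toExt σ (extAction σ (Ext.mk σ t) (of σ 0 (1 : A))) = _
      rw [extAction_mk, toExt_tensorAction, toExt_one, mul_one]
      rfl)
    (hom_ext_of fun k x => by
      change extAction σ (toExt σ (of σ k x)) (of σ 0 (1 : A)) = _
      rw [toExt_of]
      change extAction σ (Ext.mk σ (TAlg.ofTPow A Γ k x)) _ = _
      rw [extAction_mk, tensorAction_ofTPow_one]
      rfl)

theorem equivExt_apply (m : ExtModel σ) : equivExt σ m = toExt σ m := rfl

theorem equivExt_symm_ofTPow (k : ℕ) (x : TPow A Γ k) :
    (equivExt σ).symm (Ext.ofTPow σ k x) = of σ k x := by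
  rw [LinearEquiv.symm_apply_eq, equivExt_apply, toExt_of]

end ExtModel

end Model

/-! ## The representation of the Clifford algebra -/

section Representation

variable {A : Type u} [Ring A] [Algebra ℂ A]
variable {Γ : Type u} [AddCommGroup Γ] [Module ℂ Γ] [Module A Γ] [Module Aᵐᵒᵖ Γ]
  [SMulCommClass A Aᵐᵒᵖ Γ] [IsScalarTower ℂ A Γ] [IsScalarTower ℂ Aᵐᵒᵖ Γ]
variable {σ : Braiding A Γ} (g : SigmaMetric σ)

namespace ExtModel

/-- The action of the tensor algebra in which `ω ∈ Γ` acts by `create + annihilate`. -/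
noncomputable def cliffTensorAction : TAlg A Γ →ₐ[ℂ] Module.End ℂ (ExtModel σ) :=
  TAlg.liftHom (scalar σ) (create σ + annihilate g)
    (fun a ω => by
      rw [LinearMap.add_apply, LinearMap.add_apply, create_smul, annihilate_smul, mul_add])
    (fun a ω => by
      rw [LinearMap.add_apply, LinearMap.add_apply, create_op_smul, annihilate_op_smul, add_mul])

theorem cliffTensorAction_ofA (a : A) :
    cliffTensorAction g (TAlg.ofA A Γ a) = scalar σ a := TAlg.liftHom_ofA _ _ _ _ a

theorem cliffTensorAction_ι (ω : Γ) :
    cliffTensorAction g (TAlg.ι A Γ ω) = create σ ω + annihilate g ω :=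
  TAlg.liftHom_ι _ _ _ _ ω

theorem cliffTensorAction_tmul (ω η : Γ) (m : ExtModel σ) :
    cliffTensorAction g (TAlg.ofTwo A Γ (tmul A ω η)) m =
      create σ ω (create σ η m) + (create σ ω (annihilate g η m) + annihilate g ω (create σ η m)) +
        annihilate g ω (annihilate g η m) := by
  rw [TAlg.ofTwo_tmul, map_mul, cliffTensorAction_ι, cliffTensorAction_ι, Module.End.mul_apply,
    LinearMap.add_apply, LinearMap.add_apply, map_add, map_add]
  abel

theorem create_annihilate_add (k : ℕ) (ω η : Γ) (x : TPow A Γ (k + 1)) :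
    create σ ω (annihilate g η (of σ (k + 1) x)) + annihilate g ω (create σ η (of σ (k + 1) x)) =
      of σ (k + 1) (g.hom (tmul A ω η) • x +
        g.hom₁₂ (TPow A Γ (k + 1)) (lTensor Γ (σ.hom₁₂ (TPow A Γ k))
          (assocAux (TPow A Γ (k + 1)) (shuffle σ (k + 1) x)
            (σ.hom (tmul A ω η) - tmul A ω η)))) := by
  rw [create_of, annihilate_of_succ, annihilate_of_succ, create_of, ← map_add,
    tmul_contraction_add]

theorem cliffTensorAction_ofTwo_zero (ρ : BTensor A Γ Γ) (a : A) :
    cliffTensorAction g (TAlg.ofTwo A Γ ρ) (of σ 0 a) =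
      of σ 2 (assocAux (TPow A Γ 0) a ρ) + of σ 0 (g.hom ρ • a) := by
  induction ρ using tensor_induction with
  | h0 => simp only [map_zero, LinearMap.zero_apply, zero_smul, add_zero]
  | ht ω η =>
    rw [cliffTensorAction_tmul, annihilate_of_zero, map_zero, map_zero, zero_add, add_zero,
      create_of, create_of, annihilate_of_succ, contraction_tmul, shuffle_one,
      ← g.hom₁₂_assocAux]
    rfl
  | ha x y hx hy => simp only [map_add, LinearMap.add_apply, add_smul, hx, hy]; abel

theorem cliffTensorAction_ofTwo_one (ρ : BTensor A Γ Γ) (x : TPow A Γ 1) :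
    cliffTensorAction g (TAlg.ofTwo A Γ ρ) (of σ 1 x) =
      of σ 3 (assocAux (TPow A Γ 1) x ρ) +
        of σ 1 (g.hom ρ • x + g.hom₁₂ (TPow A Γ 1) (lTensor Γ (σ.hom₁₂ (TPow A Γ 0))
          (assocAux (TPow A Γ 1) (shuffle σ 1 x) (σ.hom ρ - ρ)))) := by
  induction ρ using tensor_induction with
  | h0 => simp only [map_zero, LinearMap.zero_apply, zero_smul, add_zero, sub_zero]
  | ht ω η =>
    rw [cliffTensorAction_tmul, create_annihilate_add, annihilate_of_succ g η,
      annihilate_of_zero, add_zero, create_of, create_of]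
    rfl
  | ha x y hx hy =>
    simp only [map_add, map_sub, LinearMap.add_apply, add_smul, hx, hy]; abel

theorem cliffTensorAction_ofTwo_add_two (ρ : BTensor A Γ Γ) (k : ℕ) (x : TPow A Γ (k + 2)) :
    cliffTensorAction g (TAlg.ofTwo A Γ ρ) (of σ (k + 2) x) =
      of σ (k + 4) (assocAux (TPow A Γ (k + 2)) x ρ) +
        of σ (k + 2) (g.hom ρ • x +
          g.hom₁₂ (TPow A Γ (k + 2)) (lTensor Γ (σ.hom₁₂ (TPow A Γ (k + 1)))
            (assocAux (TPow A Γ (k + 2)) (shuffle σ (k + 2) x) (σ.hom ρ - ρ)))) +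
        of σ k (contractionTwice g k x ρ) := by
  induction ρ using tensor_induction with
  | h0 => simp only [map_zero, LinearMap.zero_apply, zero_smul, add_zero, sub_zero]
  | ht ω η =>
    rw [cliffTensorAction_tmul, create_annihilate_add, annihilate_of_succ g η,
      annihilate_of_succ g ω, create_of, create_of, contractionTwice_tmul]
    rfl
  | ha x y hx hy =>
    simp only [map_add, map_sub, LinearMap.add_apply, add_smul, hx, hy]; abel

/-- The parts of degree k + 2 and k - 2 lie in kernels of antisymmetrizers, and the correction in
degree k is linear in σρ - ρ = 0. Degrees 0 and 1 are separate since some contractions vanish there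
by convention. -/
theorem cliffTensorAction_rel (ρ : BTensor A Γ Γ) (hρ : ρ - σ.hom ρ = 0) :
    cliffTensorAction g (TAlg.ofTwo A Γ ρ) =
      cliffTensorAction g (TAlg.ofA A Γ (g.hom ρ)) := by
  have hρ' : σ.hom ρ = ρ := (sub_eq_zero.1 hρ).symm
  refine hom_ext_of fun k x => ?_
  have h2 := of_eq_zero_iff.2 (antisymmetrizer_assocAux σ k x ρ hρ')
  rw [cliffTensorAction_ofA, scalar_of]
  rcases k with _ | _ | k
  · rw [cliffTensorAction_ofTwo_zero]
    exact (congrArg (· + _) h2).trans (zero_add _)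
  · rw [cliffTensorAction_ofTwo_one, hρ', sub_self, map_zero, map_zero, map_zero, add_zero]
    exact (congrArg (· + _) h2).trans (zero_add _)
  · rw [cliffTensorAction_ofTwo_add_two, hρ', sub_self, map_zero, map_zero, map_zero, add_zero,
      of_eq_zero_iff.2 (antisymmetrizer_contractionTwice g k x ρ hρ'), add_zero]
    exact (congrArg (· + _) h2).trans (zero_add _)

/-- The representation of the Clifford algebra on `⨁ₖ Γ^{⊗k} / ker A_k`. -/
noncomputable def cliffAction : Cliff g →ₐ[ℂ] Module.End ℂ (ExtModel σ) :=
  RingQuot.liftAlgHom ℂ ⟨cliffTensorAction g, fun _ _ hxy => by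
    obtain ⟨ρ, hρ⟩ := hxy
    exact cliffTensorAction_rel g ρ hρ⟩

theorem cliffAction_mk (t : TAlg A Γ) : cliffAction g (Cliff.mk g t) = cliffTensorAction g t :=
  RingQuot.liftAlgHom_mkAlgHom_apply ℂ _ _ _

end ExtModel

theorem Cliff.algHom_ext {R : Type*} [Semiring R] [Algebra ℂ R] {φ ψ : Cliff g →ₐ[ℂ] R}
    (hA : ∀ a, φ (Cliff.ofA g a) = ψ (Cliff.ofA g a))
    (hΓ : ∀ ω, φ (Cliff.ι g ω) = ψ (Cliff.ι g ω)) : φ = ψ := by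
  refine AlgHom.ext fun x => ?_
  obtain ⟨t, rfl⟩ : ∃ t, Cliff.mk g t = x := RingQuot.mkAlgHom_surjective ℂ _ x
  induction t using TAlg.induction_gen with
  | hA a => exact hA a
  | hΓ ω => exact hΓ ω
  | hadd x y hx hy => simp only [map_add, hx, hy]
  | hmul x y hx hy => simp only [map_mul, hx, hy]

/-- The contraction by one-forms on the exterior algebra. -/
noncomputable def extContraction : Γ →ₗ[ℂ] Module.End ℂ (Ext σ) :=
  (ExtModel.equivExt σ).conj.toLinearMap ∘ₗ ExtModel.annihilate g

theorem extContraction_apply (ω : Γ) (ρ : Ext σ) :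
    extContraction g ω ρ = ExtModel.equivExt σ
      (ExtModel.annihilate g ω ((ExtModel.equivExt σ).symm ρ)) := rfl

theorem extContraction_ofTPow_zero (ω : Γ) (x : TPow A Γ 0) :
    extContraction g ω (Ext.ofTPow σ 0 x) = 0 := by
  rw [extContraction_apply, ExtModel.equivExt_symm_ofTPow]
  exact (congrArg _ (ExtModel.annihilate_of_zero g ω x)).trans (map_zero _)

theorem extContraction_ofTPow_succ (ω : Γ) (l : ℕ) (x : TPow A Γ (l + 1)) :
    extContraction g ω (Ext.ofTPow σ (l + 1) x) =
      Ext.ofTPow σ l (contraction g l (tmul A ω x)) := by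
  rw [extContraction_apply, ExtModel.equivExt_symm_ofTPow, ExtModel.annihilate_of_succ,
    ExtModel.equivExt_apply, ExtModel.toExt_of]

/-- The representation of the Clifford algebra on the exterior algebra. -/
noncomputable def cliffRep : Cliff g →ₐ[ℂ] Module.End ℂ (Ext σ) :=
  ((ExtModel.equivExt σ).conjAlgEquiv ℂ).toAlgHom.comp (ExtModel.cliffAction g)

theorem cliffRep_apply (x : Cliff g) (ρ : Ext σ) :
    cliffRep g x ρ = ExtModel.equivExt σ
      (ExtModel.cliffAction g x ((ExtModel.equivExt σ).symm ρ)) := rfl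

theorem cliffRep_ofA (a : A) (ρ : Ext σ) :
    cliffRep g (Cliff.ofA g a) ρ = Ext.ofA σ a * ρ := by
  rw [cliffRep_apply, Cliff.ofA, AlgHom.comp_apply, ExtModel.cliffAction_mk,
    ExtModel.cliffTensorAction_ofA, ExtModel.equivExt_apply, ExtModel.toExt_scalar,
    ← ExtModel.equivExt_apply, LinearEquiv.apply_symm_apply]

theorem cliffRep_ι (ω : Γ) (ρ : Ext σ) :
    cliffRep g (Cliff.ι g ω) ρ = Ext.ι σ ω * ρ + extContraction g ω ρ := by
  change cliffRep g (Cliff.mk g (TAlg.ι A Γ ω)) ρ = _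
  rw [cliffRep_apply, ExtModel.cliffAction_mk, ExtModel.cliffTensorAction_ι, LinearMap.add_apply,
    map_add, extContraction_apply, ExtModel.equivExt_apply (ExtModel.create σ ω _),
    ExtModel.toExt_create, ← ExtModel.equivExt_apply, LinearEquiv.apply_symm_apply]

theorem ofTPow_eq_zero_iff (k : ℕ) (x : TPow A Γ k) :
    Ext.ofTPow σ k x = 0 ↔ antisymmetrizer σ k x = 0 := by
  rw [← ExtModel.of_eq_zero_iff, ← ExtModel.equivExt_symm_ofTPow, LinearEquiv.map_eq_zero_iff]

variable (σ) in
theorem isInternal_range_ofTPow :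
    DirectSum.IsInternal (fun k : ℕ => LinearMap.range (Ext.ofTPow σ k)) := by
  constructor
  · rw [injective_iff_map_eq_zero]
    intro f hf
    -- Carried back to the model, the degree k part of a sum sees only its k-th summand; directness
    -- is inherited from the model in this way.
    have key : ∀ (k : ℕ) (f : ⨁ k : ℕ, LinearMap.range (Ext.ofTPow σ k)),
        ExtModel.degree k ((ExtModel.equivExt σ).symm (DirectSum.coeAddMonoidHom _ f)) =
          ExtModel.degree k ((ExtModel.equivExt σ).symm (f k : Ext σ)) := by
      intro k f
      induction f using DirectSum.induction_on with
      | zero => simp only [map_zero, DirectSum.zero_apply, ZeroMemClass.coe_zero]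
      | of i y =>
        rw [DirectSum.coeAddMonoidHom_of]
        rcases eq_or_ne i k with rfl | hik
        · rw [DirectSum.of_eq_same]
        · rw [DirectSum.of_eq_of_ne _ _ _ hik.symm]
          obtain ⟨_, x, rfl⟩ := y
          rw [ExtModel.equivExt_symm_ofTPow, ExtModel.degree_of_ne hik, ZeroMemClass.coe_zero,
            map_zero, map_zero]
      | add x y hx hy =>
        rw [map_add, map_add, map_add, hx, hy, DirectSum.add_apply, Submodule.coe_add, map_add,
          map_add]
    refine DFinsupp.ext fun k => ?_
    have hk := key k f
    rw [hf, map_zero, map_zero] at hk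
    obtain ⟨x, hx⟩ := (f k).2
    rw [← hx, ExtModel.equivExt_symm_ofTPow, eq_comm, ExtModel.degree_of_eq_zero_iff,
      ← ofTPow_eq_zero_iff, hx] at hk
    exact Subtype.ext hk
  · intro ρ
    obtain ⟨m, rfl⟩ := (ExtModel.equivExt σ).surjective ρ
    induction m using ExtModel.induction_of with
    | hof k x =>
      refine ⟨DirectSum.of (fun k => LinearMap.range (Ext.ofTPow σ k)) k
        ⟨Ext.ofTPow σ k x, x, rfl⟩, ?_⟩
      rw [DirectSum.coeAddMonoidHom_of]
      exact (ExtModel.toExt_of k x).symm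
    | hadd x y hx hy =>
      obtain ⟨u, hu⟩ := hx
      obtain ⟨v, hv⟩ := hy
      exact ⟨u + v, by rw [map_add, map_add, hu, hv]⟩

theorem injective_ofA_add_ι :
    Function.Injective (fun p : A × Γ => Cliff.ofA g p.1 + Cliff.ι g p.2) := by
  have h1 : (ExtModel.equivExt σ).symm 1 = ExtModel.of σ 0 (1 : A) := by
    rw [LinearEquiv.symm_apply_eq, ExtModel.equivExt_apply, ExtModel.toExt_one]
  -- Acting on 1 separates A and Γ: the contraction of a degree 0 element vanishes, so the result is
  -- a in degree 0 plus ω ⊗ 1 in degree 1.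
  have h : ∀ p : A × Γ, (ExtModel.equivExt σ).symm
      (cliffRep g (Cliff.ofA g p.1 + Cliff.ι g p.2) 1) =
      ExtModel.of σ 0 p.1 + ExtModel.of σ 1 (tmul A p.2 (1 : A)) := by
    rintro ⟨a, ω⟩
    change (ExtModel.equivExt σ).symm (cliffRep g (Cliff.mk g (TAlg.ofA A Γ a) +
      Cliff.mk g (TAlg.ι A Γ ω)) 1) = _
    rw [cliffRep_apply, LinearEquiv.symm_apply_apply, h1, map_add, ExtModel.cliffAction_mk,
      ExtModel.cliffAction_mk, ExtModel.cliffTensorAction_ofA, ExtModel.cliffTensorAction_ι,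
      LinearMap.add_apply, LinearMap.add_apply, ExtModel.annihilate_of_zero, add_zero,
      ExtModel.scalar_of, ExtModel.create_of]
    exact congrArg (ExtModel.of σ 0 · + _) (mul_one a)
  refine (injective_iff_map_eq_zero (AddMonoidHom.coprod (Cliff.ofA g : A →+ Cliff g)
    (Cliff.ι g).toAddMonoidHom)).2 fun p hp => ?_
  have hp' := h p
  rw [show Cliff.ofA g p.1 + Cliff.ι g p.2 = 0 from hp, map_zero, LinearMap.zero_apply,
    map_zero] at hp'
  have h0 := congrArg (ExtModel.degree 0) hp'
  have h1 := congrArg (ExtModel.degree 1) hp'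
  rw [map_zero, map_add, ExtModel.degree_of_ne one_ne_zero, add_zero, eq_comm,
    ExtModel.degree_of_eq_zero_iff, antisymmetrizer_zero_apply] at h0
  rw [map_zero, map_add, ExtModel.degree_of_ne zero_ne_one, zero_add, eq_comm,
    ExtModel.degree_of_eq_zero_iff, antisymmetrizer_one_apply] at h1
  refine Prod.ext h0 ?_
  -- Degree 1 is modelled as Γ ⊗_A A; the map m ⊗ a ↦ m · a sends ω ⊗ 1 back to ω.
  have h2 : liftAdd (fun (m : Γ) (a : A) => MulOpposite.op a • m) (fun m m' a => smul_add _ m m')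
      (fun m a b => by rw [MulOpposite.op_add, add_smul])
      (fun a m b => by rw [smul_eq_mul, MulOpposite.op_mul, mul_smul]) (tmul A p.2 (1 : A)) = 0 := by
    rw [h1, map_zero]
  rwa [liftAdd_tmul, MulOpposite.op_one, one_smul] at h2

end Representation

end QClifford

open QClifford in
theorem mainTheorem4 {A : Type u} [Ring A] [Algebra ℂ A]
    {Γ : Type u} [AddCommGroup Γ] [Module ℂ Γ] [Module A Γ] [Module Aᵐᵒᵖ Γ]
    [SMulCommClass A Aᵐᵒᵖ Γ] [IsScalarTower ℂ A Γ] [IsScalarTower ℂ Aᵐᵒᵖ Γ]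
    (σ : Braiding A Γ) (g : SigmaMetric σ) :
    -- `Γ^∧` is the direct sum of the spaces `Γ^{⊗k} / ker A_k`
    (∀ (k : ℕ) (x : TPow A Γ k), Ext.ofTPow σ k x = 0 ↔ antisymmetrizer σ k x = 0) ∧
    DirectSum.IsInternal (fun k : ℕ => LinearMap.range (Ext.ofTPow σ k)) ∧
    -- the contraction by one-forms descends to `Γ^∧`
    (∃ c : Γ →ₗ[ℂ] Module.End ℂ (Ext σ),
      (∀ (ω : Γ) (a : A), c ω (Ext.ofA σ a) = 0) ∧
      (∀ (ω : Γ) (l : ℕ) (x : TPow A Γ (l + 1)),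
        c ω (Ext.ofTPow σ (l + 1) x) = Ext.ofTPow σ l (contraction g l (tmul A ω x))) ∧
      -- the representation of the Clifford algebra
      ∃! r : Cliff g →ₐ[ℂ] Module.End ℂ (Ext σ),
        (∀ (a : A) (ρ : Ext σ), r (Cliff.ofA g a) ρ = Ext.ofA σ a * ρ) ∧
        (∀ (ω : Γ) (ρ : Ext σ), r (Cliff.ι g ω) ρ = Ext.ι σ ω * ρ + c ω ρ)) ∧
    -- `A ⊕ Γ` embeds into the Clifford algebra
    Function.Injective (fun p : A × Γ => Cliff.ofA g p.1 + Cliff.ι g p.2) := by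
  refine ⟨ofTPow_eq_zero_iff, isInternal_range_ofTPow σ,
    ⟨extContraction g, fun ω a => extContraction_ofTPow_zero g ω a,
      extContraction_ofTPow_succ g, cliffRep g, ⟨cliffRep_ofA g, cliffRep_ι g⟩, ?_⟩,
    injective_ofA_add_ι g⟩
  rintro r ⟨hA, hΓ⟩
  -- Uniqueness: A and Γ generate the Clifford algebra.
  exact Cliff.algHom_ext g (fun a => LinearMap.ext fun ρ => (hA a ρ).trans (cliffRep_ofA g a ρ).symm)
    (fun ω => LinearMap.ext fun ρ => (hΓ ω ρ).trans (cliffRep_ι g ω ρ).symm)
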